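/- **The Schori solenoid.** Let $M_0$ be the closed orientable surface of genus $2$, the union of two handles (one-holed tori) meeting along their common boundary circle, and let $C_0$, $D_0$ be non-separating simple closed curves, one in the interior of each handle; concretely $$M_0=\{(z,w,s)\in S^1\times S^1\times\mathbb R : s^2=1-\operatorname{Re}z-\operatorname{Re}w\},\quad C_0=\{z=-1,\ s>0\},\quad D_0=\{z=-1,\ s<0\}.$$ Given $M_n$ with disjoint two-sided simple closed curves $C_n,D_n$, let $M_{n+1}$ be obtained by cutting three copies (numbered $1,2,3$) of $M_n$ along $C_n$ and $D_n$ and regluing: along $C_n$ the two sides of the cut in copy $1$ are glued to the opposite sides of the cut in copy $2$, and copy $3$ is glued back to itself; along $D_n$ the two sides of the cut in copy $2$ are glued to the opposite sides of the cut in copy $3$, and copy $1$ is glued back to itself. Let $p_{n+1}\colon M_{n+1}\to M_n$ be the projection. Let $C_{n+1}$ be one of the two lifts of $C_n$ along which copies $1$ and $2$ are joined, and $D_{n+1}$ one of the two lifts of $D_n$ along which copies $2$ and $3$ are joined; these choices are arbitrary at every stage. The Schori solenoid is $\mathcal S=\varprojlim\{p_{n+1}\colon M_{n+1}\to M_n\}$.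 **Definitions.** Let $\Pi_0\colon\mathcal S\to M_0$ be the projection. For $x_0\in M_0$ let $\mathfrak X_0=\Pi_0^{-1}(x_0)$, and let $H\subset \mathrm{Homeo}(\mathfrak X_0)$ be the global monodromy group, i.e. the group of homeomorphisms $h$ for which there is a loop $\gamma$ at $x_0$ such that every $y\in\mathfrak X_0$ is joined to $h(y)$ by a path in $\mathcal S$ lifting $\gamma$. Let $H$ act by homeomorphisms on a Cantor space $X$. For $U\subset X$ let $\mathcal H_U\subset\mathrm{Homeo}(U)$ be the group of restrictions to $U$ of the elements $g\in H$ with $g(U)=U$. A non-empty clopen set $U$ is *adapted* if for all $g\in H$ and all open $W\subset U$ with $g(W)\subset U$ the map $g|_W$ is the restriction of an element of $\mathcal H_U$. For $V\subset U$ let $\mathcal H_{U,V}=\{f\in\mathcal H_U : f(V)=V\}$, and let $\overline{\mathcal H_{U,V}}$ be its closure in $\mathrm{Homeo}(U)$ in the uniform topology on maps. An equicontinuous action is *stable* if every $x\in X$ lies in an adapted set $U$ such that for every adapted $V\subset U$ the only element of $\overline{\mathcal H_{U,V}}$ that restricts to the identity on $V$ is the identity; otherwise it is *wild*. For $x=(x_\ell)\in\mathcal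 S$ let $G_\ell\subset\pi_1(M_0,x_0)$ be the image of $\pi_1(M_\ell,x_\ell)$ under $q_\ell=p_1\circ\dots\circ p_\ell$. For $\ell\ge n$ let $C_{n,\ell}=\bigcap_{g\in G_n}gG_\ell g^{-1}$, and let $\mathcal D_n=\varprojlim_{\ell\ge n}G_\ell/C_{n,\ell}$ be the discriminant group of the chain $\{G_\ell\}_{\ell\ge n}$. For $m\ge n$ let $\psi_{n,m}\colon\mathcal D_n\to\mathcal D_m$, $(g_\ell C_{n,\ell})_{\ell\ge n}\mapsto(g_\ell C_{m,\ell})_{\ell\ge m}$. The chain is *stable* if there is $n_0$ such that $\psi_{n,m}$ is an isomorphism for all $m\ge n\ge n_0$, and *wild* otherwise. **Theorem.** For every choice of the lifts $C_n$, $D_n$ $(n\ge1)$: 1. every $M_n$ is connected and every $p_{n+1}\colon M_{n+1}\to M_n$ is a $3$-to-$1$ covering map; 2. the solenoid $\mathcal S$ is wild: for every $x\in\mathcal S$ the group chain $\{G_\ell\}$ of $x$ is wild, i.e. its discriminant groups never stabilize; 3. for every $x_0\in M_0$ the global monodromy action on $\mathfrak X_0$ is wild: $\mathfrak X_0$ is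 a Cantor space, the action is equicontinuous, and it is not stable. -/

import Mathlib

open Set Topology

noncomputable section

/-! ## Group actions on Cantor spaces: adapted sets, closures, stability -/

section Actions

variable {X : Type*} [TopologicalSpace X]

/-- A Cantor space: a non-empty compact metrizable totally disconnected space without isolated
points. -/
def IsCantorSpace (X : Type*) [TopologicalSpace X] : Prop :=
  Nonempty X ∧ CompactSpace X ∧ TopologicalSpace.MetrizableSpace X ∧
    TotallyDisconnectedSpace X ∧ PerfectSpace X

/-- Equicontinuity of a group of homeomorphisms, written with neighbourhoods of the diagonal.
On a compact Hausdorff space these neighbourhoods are the entourages of every compatible metric,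
so this is uniform `ε`-`δ` equicontinuity with respect to any compatible metric. -/
def IsEquicontinuousAction (H : Subgroup (X ≃ₜ X)) : Prop :=
  ∀ N ∈ 𝓝ˢ (diagonal X), ∃ N' ∈ 𝓝ˢ (diagonal X),
    ∀ g ∈ H, ∀ w w' : X, (w, w') ∈ N' → (g w, g w') ∈ N

/-- The group of homeomorphisms of `U` that are restrictions of elements of `H`. -/
def inducedGroup (H : Subgroup (X ≃ₜ X)) (U : Set X) : Subgroup (U ≃ₜ U) where
  carrier := {f | ∃ g ∈ H, ∀ u : U, ((f u : U) : X) = g (u : X)}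
  mul_mem' := by
    rintro f₁ f₂ ⟨g₁, h₁, e₁⟩ ⟨g₂, h₂, e₂⟩
    refine ⟨g₁ * g₂, H.mul_mem h₁ h₂, fun u => ?_⟩
    change ((f₁ (f₂ u) : U) : X) = g₁ (g₂ u)
    rw [e₁, e₂]
  one_mem' := ⟨1, H.one_mem, fun _ => rfl⟩
  inv_mem' := by
    rintro f ⟨g, h, e⟩
    refine ⟨g⁻¹, H.inv_mem h, fun u => ?_⟩
    change ((f.symm u : U) : X) = g.symm u
    rw [← g.symm_apply_apply ((f.symm u : U) : X), ← e, f.apply_symm_apply]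

/-- The non-empty clopen set `U` is adapted to the action of `H`: every map `g|W : W → U` with
`g ∈ H` and `W ⊆ U` open (that is, every element of the pseudogroup of the action restricted
to `U`) is the restriction of an element of the group `inducedGroup H U` acting on `U`. -/
def IsAdapted (H : Subgroup (X ≃ₜ X)) (U : Set X) : Prop :=
  IsClopen U ∧ U.Nonempty ∧
    ∀ g ∈ H, ∀ W : Set X, IsOpen W → W ⊆ U → MapsTo g W U →
      ∃ f ∈ inducedGroup H U, ∀ u : U, (u : X) ∈ W → ((f u : U) : X) = g (u : X)

/-- The elements of `inducedGroup H U` that map `V` onto itself, for `V ⊆ U`. -/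
def inducedStabilizer (H : Subgroup (X ≃ₜ X)) (U V : Set X) : Set (U ≃ₜ U) :=
  {f | f ∈ inducedGroup H U ∧ f '' {u : U | (u : X) ∈ V} = {u : U | (u : X) ∈ V}}

/-- The closure of a set of homeomorphisms of `Y` in the compact-open topology on maps; for compact
`Y` this is the topology of uniform convergence. -/
def homeoClosure {Y : Type*} [TopologicalSpace Y] (K : Set (Y ≃ₜ Y)) : Set (Y ≃ₜ Y) :=
  {f | (f : C(Y, Y)) ∈ closure ((fun k : Y ≃ₜ Y => (k : C(Y, Y))) '' K)}

/-- The action of `H` is stable: every point lies in an adapted clopen set `U` such that for every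
adapted clopen `V ⊆ U`, the restriction to `V`, on the closure of the group of elements of the
induced group of `U` preserving `V`, has trivial kernel. -/
def IsStableAction (H : Subgroup (X ≃ₜ X)) : Prop :=
  ∀ x : X, ∃ U : Set X, IsAdapted H U ∧ x ∈ U ∧
    ∀ V : Set X, V ⊆ U → IsAdapted H V →
      ∀ f ∈ homeoClosure (inducedStabilizer H U V),
        (∀ u : U, (u : X) ∈ V → f u = u) → f = Homeomorph.refl U

/-- A wild action: an equicontinuous action on a Cantor space that is not stable. -/
def IsWildAction (H : Subgroup (X ≃ₜ X)) : Prop :=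
  IsCantorSpace X ∧ IsEquicontinuousAction H ∧ ¬ IsStableAction H

end Actions

/-! ## Group chains and their discriminant groups -/

/-- A descending chain of subgroups of a group. -/
structure GroupChain (Γ : Type*) [Group Γ] where
  grp : ℕ → Subgroup Γ
  anti : Antitone grp

namespace GroupChain

variable {Γ : Type*} [Group Γ] (𝒢 : GroupChain Γ)

/-- The core of `G_ℓ` in `G_n`: the intersection of the conjugates `g G_ℓ g⁻¹`, `g ∈ G_n`. -/
def core (n ℓ : ℕ) : Subgroup Γ :=
  ⨅ g : 𝒢.grp n, (𝒢.grp ℓ).map (MulAut.conj (g : Γ)).toMonoidHom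

theorem mem_core {n ℓ : ℕ} {h : Γ} :
    h ∈ 𝒢.core n ℓ ↔ ∀ g ∈ 𝒢.grp n, g⁻¹ * h * g ∈ 𝒢.grp ℓ := by
  simp only [core, Subgroup.mem_iInf, Subtype.forall, Subgroup.mem_map]
  refine forall₂_congr fun g _ => ⟨?_, fun hg => ⟨_, hg, ?_⟩⟩
  · rintro ⟨a, ha, rfl⟩
    simpa [mul_assoc] using ha
  · simp [mul_assoc]

theorem core_normal {n ℓ : ℕ} (hn : n ≤ ℓ) :
    ((𝒢.core n ℓ).subgroupOf (𝒢.grp ℓ)).Normal := by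
  refine ⟨fun a ha k => ?_⟩
  rw [Subgroup.mem_subgroupOf, mem_core] at *
  intro g hg
  have := ha ((k : Γ)⁻¹ * g) (mul_mem (inv_mem (𝒢.anti hn k.2)) hg)
  simpa [mul_assoc] using this

instance (n : ℕ) (ℓ : {ℓ : ℕ // n ≤ ℓ}) : ((𝒢.core n ℓ).subgroupOf (𝒢.grp ℓ)).Normal :=
  𝒢.core_normal ℓ.2

/-- The quotient group `G_ℓ / C_{n,ℓ}`, for `ℓ ≥ n`, where `C_{n,ℓ}` is the core of `G_ℓ` in
`G_n`. -/
abbrev Quot (n : ℕ) (ℓ : {ℓ : ℕ // n ≤ ℓ}) : Type _ :=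
  𝒢.grp ℓ ⧸ (𝒢.core n ℓ).subgroupOf (𝒢.grp ℓ)

/-- The index `ℓ + 1`. -/
def succIndex {n : ℕ} (ℓ : {ℓ : ℕ // n ≤ ℓ}) : {ℓ : ℕ // n ≤ ℓ} := ⟨ℓ + 1, ℓ.2.trans (Nat.le_succ _)⟩

/-- The bonding homomorphism `G_{ℓ+1} / C_{n,ℓ+1} → G_ℓ / C_{n,ℓ}` induced by inclusion. -/
def bond (n : ℕ) (ℓ : {ℓ : ℕ // n ≤ ℓ}) : 𝒢.Quot n (succIndex ℓ) →* 𝒢.Quot n ℓ :=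
  QuotientGroup.map _ _ (Subgroup.inclusion (𝒢.anti (Nat.le_succ ℓ))) (by
    intro a ha
    rw [Subgroup.mem_comap, Subgroup.mem_subgroupOf, mem_core]
    rw [Subgroup.mem_subgroupOf, mem_core] at ha
    exact fun g hg => 𝒢.anti (Nat.le_succ ℓ) (ha g hg))

/-- The discriminant group `D_n` of the truncated chain `G_n ⊇ G_{n+1} ⊇ ⋯`: the inverse limit of
the groups `G_ℓ / C_{n,ℓ}`, `ℓ ≥ n`. -/
def discriminant (n : ℕ) : Subgroup (∀ ℓ : {ℓ : ℕ // n ≤ ℓ}, 𝒢.Quot n ℓ) where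
  carrier := {a | ∀ ℓ : {ℓ : ℕ // n ≤ ℓ}, 𝒢.bond n ℓ (a (succIndex ℓ)) = a ℓ}
  mul_mem' := fun ha hb ℓ => by simp [ha ℓ, hb ℓ]
  one_mem' := fun ℓ => by simp
  inv_mem' := fun ha ℓ => by simp [ha ℓ]

/-- The homomorphism `G_ℓ / C_{n,ℓ} → G_ℓ / C_{m,ℓ}` induced by the identity, for
`n ≤ m ≤ ℓ`. -/
def change {n m : ℕ} (h : n ≤ m) (ℓ : {ℓ : ℕ // m ≤ ℓ}) : 𝒢.Quot n ⟨ℓ, h.trans ℓ.2⟩ →* 𝒢.Quot m ℓ :=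
  QuotientGroup.map _ _ (MonoidHom.id _) (by
    intro a ha
    rw [Subgroup.mem_comap, Subgroup.mem_subgroupOf, mem_core]
    rw [Subgroup.mem_subgroupOf, mem_core] at ha
    exact fun g hg => ha g (𝒢.anti h hg))

/-- The homomorphism `ψ_{n,m} : D_n → D_m`, `(g_ℓ C_{n,ℓ})_{ℓ ≥ n} ↦ (g_ℓ C_{m,ℓ})_{ℓ ≥ m}`. -/
def discriminantMap {n m : ℕ} (h : n ≤ m) : 𝒢.discriminant n →* 𝒢.discriminant m where
  toFun a := ⟨fun ℓ => 𝒢.change h ℓ (a.1 ⟨ℓ, h.trans ℓ.2⟩), fun ℓ => by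
    have key : ∀ b : 𝒢.Quot n (succIndex ⟨ℓ, h.trans ℓ.2⟩),
        𝒢.bond m ℓ (𝒢.change h (succIndex ℓ) b) =
          𝒢.change h ℓ (𝒢.bond n ⟨ℓ, h.trans ℓ.2⟩ b) := by
      intro b
      induction b using QuotientGroup.induction_on with
      | H b => rfl
    exact (key _).trans (congrArg (𝒢.change h ℓ) (a.2 ⟨ℓ, h.trans ℓ.2⟩))⟩
  map_one' := by
    ext ℓ
    exact map_one (𝒢.change h ℓ)
  map_mul' a b := by
    ext ℓ
    exact map_mul (𝒢.change h ℓ) _ _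

/-- The chain is stable: from some index on, all maps `D_n → D_m` are isomorphisms. -/
def IsStable : Prop :=
  ∃ n₀ : ℕ, ∀ n m : ℕ, n₀ ≤ n → ∀ h : n ≤ m, Function.Bijective (𝒢.discriminantMap h)

end GroupChain

/-! ## Towers of spaces, their inverse limits, monodromy and group chains -/

/-- An inverse sequence `M 0 ← M 1 ← M 2 ← ⋯` of spaces and continuous maps. -/
structure Tower where
  M : ℕ → Type
  top : ∀ n, TopologicalSpace (M n)
  p : ∀ n, M (n + 1) → M n
  cont : ∀ n, Continuous (p n)

namespace Tower

attribute [instance] Tower.top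

variable (P : Tower)

/-- The inverse limit, with the topology induced from the product. -/
abbrev Limit : Type := {x : ∀ n, P.M n // ∀ n, P.p n (x (n + 1)) = x n}

/-- The composition `q_ℓ = p_0 ∘ ⋯ ∘ p_{ℓ-1} : M ℓ → M 0`. -/
def q : ∀ ℓ : ℕ, C(P.M ℓ, P.M 0)
  | 0 => ContinuousMap.id _
  | ℓ + 1 => (q ℓ).comp ⟨P.p ℓ, P.cont ℓ⟩

theorem q_apply (x : P.Limit) : ∀ ℓ : ℕ, P.q ℓ (x.1 ℓ) = x.1 0
  | 0 => rfl
  | ℓ + 1 => by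
    rw [← q_apply x ℓ, ← x.2 ℓ]
    rfl

/-- The fibre over `x₀` of the projection of the inverse limit to the base `M 0`. -/
abbrev Fiber (x₀ : P.M 0) : Type := {y : P.Limit // y.1 0 = x₀}

/-- The global monodromy group: the homeomorphisms `h` of the fibre over `x₀` given by
transport along the leaves over a loop `γ` at `x₀`, i.e. every `y` in the fibre is joined to `h y`
by a path in the inverse limit that lifts `γ`. It is the image of `π₁(M 0, x₀)` in the
homeomorphism group of the fibre under the monodromy action. -/
def monodromyGroup (x₀ : P.M 0) : Subgroup (P.Fiber x₀ ≃ₜ P.Fiber x₀) where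
  carrier := {h | ∃ γ : Path x₀ x₀, ∀ y : P.Fiber x₀,
    ∃ Λ : Path (y : P.Limit) (h y : P.Limit), ∀ t, (Λ t).1 0 = γ t}
  one_mem' := ⟨Path.refl x₀, fun y => ⟨Path.refl _, fun _ => y.2⟩⟩
  mul_mem' := by
    rintro h₁ h₂ ⟨γ₁, H₁⟩ ⟨γ₂, H₂⟩
    refine ⟨γ₂.trans γ₁, fun y => ?_⟩
    obtain ⟨Λ₂, e₂⟩ := H₂ y
    obtain ⟨Λ₁, e₁⟩ := H₁ (h₂ y)
    have key : ∀ t, ((Λ₂.trans Λ₁) t).1 0 = (γ₂.trans γ₁) t := by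
      intro t
      rw [Path.trans_apply, Path.trans_apply]
      split_ifs
      · exact e₂ _
      · exact e₁ _
    exact ⟨Λ₂.trans Λ₁, key⟩
  inv_mem' := by
    rintro h ⟨γ, H⟩
    refine ⟨γ.symm, fun y => ?_⟩
    obtain ⟨Λ, e⟩ := H (h.symm y)
    refine ⟨Λ.symm.cast (by rw [h.apply_symm_apply]) rfl, fun t => ?_⟩
    exact e _

/-- The group chain of a point `x` of the inverse limit: `G_ℓ` is the image of
`π₁(M ℓ, x_ℓ)` in `π₁(M 0, x_0)` under `q_ℓ`. -/
def groupChain (x : P.Limit) : GroupChain (FundamentalGroup (P.M 0) (x.1 0)) where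
  grp ℓ := (FundamentalGroup.mapOfEq (P.q ℓ) (P.q_apply x ℓ)).range
  anti := antitone_nat_of_succ_le fun ℓ => by
    rintro _ ⟨a, rfl⟩
    refine ⟨FundamentalGroup.mapOfEq ⟨P.p ℓ, P.cont ℓ⟩ (x.2 ℓ) a, ?_⟩
    simp only [FundamentalGroup.mapOfEq_apply]
    induction a using Quotient.inductionOn with
    | h a => rfl

end Tower

/-! ## The surfaces -/

/-- A space with two marked curves, each given with a two-sided collar `circle × ℝ`;
the curves themselves are the cores `circle × {0}` of the collars. -/
structure MarkedSurface where
  carrier : Type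
  top : TopologicalSpace carrier
  collarC : Circle × ℝ → carrier
  collarD : Circle × ℝ → carrier
  contC : Continuous collarC
  contD : Continuous collarD

namespace MarkedSurface

attribute [instance] MarkedSurface.top

variable (S : MarkedSurface)

/-- The complement of the two marked curves. -/
def offCurves : Set S.carrier :=
  {x | ∀ z : Circle, x ≠ S.collarC (z, 0) ∧ x ≠ S.collarD (z, 0)}

/-- The underlying set of three copies of the surface, after regluing. -/
def Copies : Type := S.carrier × Fin 3

/-- The collar that crosses from copy `i` (on the side `t ≤ 0`) to copy `σ i` (on the side
`t > 0`). -/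
def crossing (κ : Circle × ℝ → S.carrier) (σ : Equiv.Perm (Fin 3)) (i : Fin 3) :
    Circle × ℝ → S.Copies :=
  fun q => (κ q, if q.2 ≤ 0 then i else σ i)

/-- Inclusion in copy `i` of the complement of the curves. -/
def sheet (i : Fin 3) : S.offCurves → S.Copies := fun x => (x.1, i)

/-- The topology obtained by cutting three copies of the surface along both curves and regluing:
along the first curve copies `0` and `1` are cross-joined and copy `2` is glued back to itself;
along the second curve copies `1` and `2` are cross-joined and copy `0` is glued back to itself.
It is the final topology for the three copies of the complement of the curves and the
three reglued copies of each collar. -/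
instance topCopies : TopologicalSpace S.Copies :=
  (⨆ i : Fin 3, TopologicalSpace.coinduced (S.sheet i) inferInstance) ⊔
  (⨆ i : Fin 3, TopologicalSpace.coinduced (S.crossing S.collarC (Equiv.swap 0 1) i)
    inferInstance) ⊔
  (⨆ i : Fin 3, TopologicalSpace.coinduced (S.crossing S.collarD (Equiv.swap 1 2) i)
    inferInstance)

theorem continuous_crossingC (i : Fin 3) :
    Continuous (S.crossing S.collarC (Equiv.swap 0 1) i) :=
  continuous_iff_coinduced_le.2 <|
    (le_iSup (fun i : Fin 3 => TopologicalSpace.coinduced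
      (S.crossing S.collarC (Equiv.swap 0 1) i) inferInstance) i).trans
      (le_sup_right.trans le_sup_left)

theorem continuous_crossingD (i : Fin 3) :
    Continuous (S.crossing S.collarD (Equiv.swap 1 2) i) :=
  continuous_iff_coinduced_le.2 <|
    (le_iSup (fun i : Fin 3 => TopologicalSpace.coinduced
      (S.crossing S.collarD (Equiv.swap 1 2) i) inferInstance) i).trans le_sup_right

/-- The projection of the reglued copies to the surface. -/
def proj : S.Copies → S.carrier := Prod.fst

theorem continuous_proj : Continuous S.proj := by
  have h₀ : ∀ i, Continuous (S.proj ∘ S.sheet i) := fun i => continuous_subtype_val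
  have h₁ : ∀ i, Continuous (S.proj ∘ S.crossing S.collarC (Equiv.swap 0 1) i) :=
    fun i => S.contC
  have h₂ : ∀ i, Continuous (S.proj ∘ S.crossing S.collarD (Equiv.swap 1 2) i) :=
    fun i => S.contD
  refine continuous_iff_le_induced.2 (sup_le (sup_le ?_ ?_) ?_)
  · exact iSup_le fun i => continuous_iff_le_induced.1 (continuous_coinduced_dom.2 (h₀ i))
  · exact iSup_le fun i => continuous_iff_le_induced.1 (continuous_coinduced_dom.2 (h₁ i))
  · exact iSup_le fun i => continuous_iff_le_induced.1 (continuous_coinduced_dom.2 (h₂ i))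

/-- The threefold covering surface. Its first marked curve is one of the two lifts of the
first marked curve along which copies `0` and `1` are joined, its second marked curve is one of the
two lifts of the second marked curve along which copies `1` and `2` are joined; `c` and `d` say
which lifts. -/
def triple (c d : Bool) : MarkedSurface where
  carrier := S.Copies
  top := S.topCopies
  collarC := S.crossing S.collarC (Equiv.swap 0 1) (if c then 0 else 1)
  collarD := S.crossing S.collarD (Equiv.swap 1 2) (if d then 1 else 2)
  contC := S.continuous_crossingC (if c then 0 else 1)
  contD := S.continuous_crossingD (if d then 1 else 2)

end MarkedSurface

/-- The closed orientable surface of genus two, as the double of a one-holed torus: the set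
of `(z, w, s)` in `S¹ × S¹ × ℝ` with `s² = 1 - Re z - Re w`. The two one-holed tori
`s ≥ 0` and `s ≤ 0` (the region `Re z + Re w > 1` removed from the torus is an open disc) meet
along their common boundary circle `s = 0`. -/
abbrev GenusTwo : Type :=
  {v : Circle × Circle × ℝ // v.2.2 ^ 2 = 1 - (v.1 : ℂ).re - (v.2.1 : ℂ).re}

/-- The first coordinate `-exp (i arctan t)` of a collar point, which runs over the open half circle
`Re z < 0`, with `z = -1` for `t = 0`. -/
def halfCircle (t : ℝ) : Circle := -Circle.exp (Real.arctan t)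

theorem continuous_halfCircle : Continuous halfCircle :=
  (Circle.exp.continuous.comp Real.continuous_arctan).neg

theorem collar_nonneg (q : Circle × ℝ) :
    0 ≤ 1 - (halfCircle q.2 : ℂ).re - (q.1 : ℂ).re := by
  have h1 : (halfCircle q.2 : ℂ).re = -Real.cos (Real.arctan q.2) := by
    simpa [halfCircle] using Complex.exp_ofReal_mul_I_re (Real.arctan q.2)
  have h2 : (q.1 : ℂ).re ≤ 1 := by
    have := Complex.re_le_norm (q.1 : ℂ)
    rwa [Circle.norm_coe] at this
  have h3 := Real.cos_arctan_pos q.2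
  rw [h1]
  linarith

/-- The collar of the curve `z = -1` in the handle `s ≥ 0` (for `ε = 1`) or `s ≤ 0`
(for `ε = -1`). -/
def genusTwoCollar (ε : ℝ) (hε : ε ^ 2 = 1) (q : Circle × ℝ) : GenusTwo :=
  ⟨(halfCircle q.2, q.1, ε * √(1 - (halfCircle q.2 : ℂ).re - (q.1 : ℂ).re)), by
    rw [mul_pow, hε, one_mul, Real.sq_sqrt (collar_nonneg q)]⟩

theorem continuous_genusTwoCollar (ε : ℝ) (hε : ε ^ 2 = 1) :
    Continuous (genusTwoCollar ε hε) := by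
  have h : Continuous fun q : Circle × ℝ => halfCircle q.2 :=
    continuous_halfCircle.comp continuous_snd
  refine Continuous.subtype_mk (h.prodMk (continuous_fst.prodMk ?_)) _
  refine continuous_const.mul (Real.continuous_sqrt.comp ?_)
  exact (continuous_const.sub (Complex.continuous_re.comp (continuous_subtype_val.comp h))).sub
    (Complex.continuous_re.comp (continuous_subtype_val.comp continuous_fst))

/-- The genus two surface with the curve `z = -1` marked in each of its two handles. -/
def markedGenusTwo : MarkedSurface where
  carrier := GenusTwo
  top := inferInstance
  collarC := genusTwoCollar 1 (by norm_num)
  collarD := genusTwoCollar (-1) (by norm_num)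
  contC := continuous_genusTwoCollar _ _
  contD := continuous_genusTwoCollar _ _

/-- The surfaces of the Schori construction, for given choices of lifts of the curves. -/
def schoriSurface (c d : ℕ → Bool) : ℕ → MarkedSurface
  | 0 => markedGenusTwo
  | n + 1 => (schoriSurface c d n).triple (c n) (d n)

/-- The tower of surfaces whose inverse limit is the Schori solenoid. -/
def schoriTower (c d : ℕ → Bool) : Tower where
  M n := (schoriSurface c d n).carrier
  top n := (schoriSurface c d n).top
  p n := (schoriSurface c d n).proj
  cont n := (schoriSurface c d n).continuous_proj

end

/-! Everything rests on an invariant of marked surfaces, `IsRegular`, which holds for the genus two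
surface and passes to the triple. The complement of the marked curves stays path-connected because
copies `0`, `1` are joined along two lifts of the first curve and copies `1`, `2` along two lifts of
the second, and only one lift of each pair is marked. Regularity also makes the projection a
covering (`isCoveringMap_proj`) and each stage path-connected.

Wildness comes from one loop per stage (`exists_crossing_loop`). A loop in `M n` that crosses the
first curve once and misses the second has a closed lift `β` in copy `2`, where that curve is glued
back to itself, and a lift `ρ` from copy `0` to copy `1`. The curve crossed by `β` is an unmarked
lift, so `β` misses both marked curves of `M (n + 1)`. All later cutting and regluing happens away
from `β`, so every lift of `β` to the solenoid is closed; yet the image of `β` in `M n` has the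
non-closed lift `ρ`. This is `HasTransientLoops`.

Hence the class of such a loop lies in every core relative to `G_{n+1}` but not in the core of
`G_{n+1}` in `G_n`, so `ψ_{n,n+1}` has a non-trivial kernel. In the fibre, its monodromy is the
identity on a cylinder of level `n + 1` but not on the surrounding cylinder of level `n`, which
contradicts stability. The rest is unique path lifting: it makes the monodromy preserve agreement at
each level, hence equicontinuous, while sheet labels identify the fibre with the Cantor space `ℕ →
Fin 3`. -/

noncomputable section

/-! ### The threefold covering of a regular marked surface. -/

/-- A point in the range of an open embedding `e` is evenly covered if `e` has disjoint open lifts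
which cover the preimage of the range. -/
theorem isEvenlyCovered_of_lifts {E X V I : Type*} [TopologicalSpace E] [TopologicalSpace X]
    [TopologicalSpace V] [TopologicalSpace I] [DiscreteTopology I] {p : E → X} (hp : Continuous p)
    {e : V → X} (he : IsOpenEmbedding e) {s : I → V → E} (hs : ∀ i, IsOpenEmbedding (s i))
    (hps : ∀ i v, p (s i v) = e v) (hinj : ∀ i j v, s i v = s j v → i = j)
    (hsurj : ∀ y v, p y = e v → ∃ i, s i v = y) (v₀ : V) : IsEvenlyCovered p (e v₀) I := by
  let F : V × I → p ⁻¹' range e := fun w => ⟨s w.2 w.1, by rw [mem_preimage, hps]; exact ⟨_, rfl⟩⟩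
  have hF : Continuous F :=
    Continuous.subtype_mk (continuous_prod_of_discrete_right.2 fun i => (hs i).continuous) _
  have hbij : Function.Bijective F := by
    constructor
    · rintro ⟨v, i⟩ ⟨w, j⟩ h
      have h' : s i v = s j w := congrArg Subtype.val h
      have hvw : v = w := he.injective (by rw [← hps i, h', hps])
      subst hvw
      rw [hinj _ _ _ h']
    · rintro ⟨y, v, hv⟩
      obtain ⟨i, hi⟩ := hsurj y v hv.symm
      exact ⟨(v, i), Subtype.ext hi⟩
  have hopen : IsOpenMap F := by
    intro O hO
    have : F '' O = Subtype.val ⁻¹' (⋃ i, s i '' ((fun v => (v, i)) ⁻¹' O)) := by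
      ext y
      simp only [mem_image, mem_preimage, mem_iUnion, Prod.exists]
      constructor
      · rintro ⟨v, i, h, rfl⟩
        exact ⟨i, v, h, rfl⟩
      · rintro ⟨i, v, h, h'⟩
        exact ⟨v, i, h, Subtype.ext h'⟩
    rw [this]
    exact (isOpen_iUnion fun i => (hs i).isOpenMap _
      (hO.preimage (Continuous.prodMk_left i))).preimage continuous_subtype_val
  let G : V × I ≃ₜ p ⁻¹' range e :=
    (Equiv.ofBijective F hbij).toHomeomorphOfContinuousOpen hF hopen
  let K : V ≃ₜ range e := he.isEmbedding.toHomeomorph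
  refine ⟨inferInstance, range e, ⟨v₀, rfl⟩, he.isOpen_range, he.isOpen_range.preimage hp,
    G.symm.trans (K.prodCongr (Homeomorph.refl I)), fun y => ?_⟩
  obtain ⟨w, rfl⟩ := G.surjective y
  simp only [Homeomorph.trans_apply, Homeomorph.symm_apply_apply]
  exact (hps w.2 w.1).symm

namespace MarkedSurface

/-- The two collars are disjoint open collars, and the complement of the two curves is open and
path-connected. -/
structure IsRegular (S : MarkedSurface) : Prop where
  embC : IsOpenEmbedding S.collarC
  embD : IsOpenEmbedding S.collarD
  disj : ∀ q q', S.collarC q ≠ S.collarD q'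
  isOpen_offCurves : IsOpen S.offCurves
  isPathConnected_offCurves : IsPathConnected S.offCurves

variable {S : MarkedSurface}

theorem isOpen_copies_iff {U : Set S.Copies} :
    IsOpen U ↔ (∀ i, IsOpen (S.sheet i ⁻¹' U)) ∧
      (∀ i, IsOpen (S.crossing S.collarC (Equiv.swap 0 1) i ⁻¹' U)) ∧
      ∀ i, IsOpen (S.crossing S.collarD (Equiv.swap 1 2) i ⁻¹' U) := by
  simp only [← isOpen_coinduced]
  rw [topCopies]
  constructor
  · intro h
    refine ⟨fun i => ?_, fun i => ?_, fun i => ?_⟩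
    · exact (le_iSup (fun i : Fin 3 => TopologicalSpace.coinduced (S.sheet i) inferInstance)
        i).trans (le_sup_left.trans le_sup_left) _ h
    · exact (le_iSup (fun i : Fin 3 => TopologicalSpace.coinduced
        (S.crossing S.collarC (Equiv.swap 0 1) i) inferInstance) i).trans
        (le_sup_right.trans le_sup_left) _ h
    · exact (le_iSup (fun i : Fin 3 => TopologicalSpace.coinduced
        (S.crossing S.collarD (Equiv.swap 1 2) i) inferInstance) i).trans le_sup_right _ h
  · rintro ⟨h₀, h₁, h₂⟩
    exact ⟨⟨isOpen_iSup_iff.2 h₀, isOpen_iSup_iff.2 h₁⟩, isOpen_iSup_iff.2 h₂⟩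

theorem continuous_sheet (i : Fin 3) : Continuous (S.sheet i) :=
  continuous_def.2 fun _ hU => (isOpen_copies_iff.1 hU).1 i

theorem collarC_mem_offCurves (h : S.IsRegular) (q : Circle × ℝ) :
    S.collarC q ∈ S.offCurves ↔ q.2 ≠ 0 := by
  constructor
  · rintro hq h0
    exact (hq q.1).1 (by rw [← h0])
  · exact fun hq z => ⟨fun e => hq (by rw [h.embC.injective e]), h.disj _ _⟩

theorem collarD_mem_offCurves (h : S.IsRegular) (q : Circle × ℝ) :
    S.collarD q ∈ S.offCurves ↔ q.2 ≠ 0 := by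
  constructor
  · rintro hq h0
    exact (hq q.1).2 (by rw [← h0])
  · exact fun hq z => ⟨fun e => h.disj _ _ e.symm, fun e => hq (by rw [h.embD.injective e])⟩

theorem crossing_injective {κ : Circle × ℝ → S.carrier} (hκ : Function.Injective κ)
    {σ : Equiv.Perm (Fin 3)} {i j : Fin 3} {q q' : Circle × ℝ}
    (e : S.crossing κ σ i q = S.crossing κ σ j q') : q = q' ∧ i = j := by
  have e₁ : q = q' := hκ (congrArg Prod.fst e)
  subst e₁
  have e₂ : (if q.2 ≤ 0 then i else σ i) = (if q.2 ≤ 0 then j else σ j) := congrArg Prod.snd e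
  refine ⟨rfl, ?_⟩
  split_ifs at e₂
  · exact e₂
  · exact σ.injective e₂

/-- The copy index along a crossing jumps only at the core `t = 0`; off the core it is locally
constant. -/
theorem isOpen_crossing_snd (σ : Equiv.Perm (Fin 3)) (i j : Fin 3) :
    IsOpen {q : Circle × ℝ | q.2 ≠ 0 ∧ (if q.2 ≤ 0 then i else σ i) = j} := by
  have : {q : Circle × ℝ | q.2 ≠ 0 ∧ (if q.2 ≤ 0 then i else σ i) = j} =
      {q | q.2 < 0 ∧ i = j} ∪ {q | 0 < q.2 ∧ σ i = j} := by
    ext q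
    simp only [mem_ofPred_eq, mem_union]
    rcases lt_trichotomy q.2 0 with hq | hq | hq
    · simp [hq.ne, hq.le, hq, hq.not_gt]
    · simp [hq]
    · simp [hq.ne', hq.not_ge, hq, hq.not_gt]
  rw [this]
  exact ((isOpen_lt continuous_snd continuous_const).and isOpen_const).union
    ((isOpen_lt continuous_const continuous_snd).and isOpen_const)

/-- Stated for a pair `κ`, `κ'` so that it serves both curves with the roles exchanged. An image is
tested on the defining charts of the final topology: sheets see only its part off the core,
crossings of the same collar are pairwise disjoint, and crossings of the other collar miss it. -/
theorem isOpenMap_crossing {κ κ' : Circle × ℝ → S.carrier} {σ σ' : Equiv.Perm (Fin 3)}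
    (hκ : IsOpenEmbedding κ) (hκκ' : ∀ q q', κ q ≠ κ' q')
    (hoff : ∀ q, κ q ∈ S.offCurves → q.2 ≠ 0)
    (htop : ∀ U : Set S.Copies, (∀ i, IsOpen (S.sheet i ⁻¹' U)) →
      (∀ i, IsOpen (S.crossing κ σ i ⁻¹' U)) → (∀ i, IsOpen (S.crossing κ' σ' i ⁻¹' U)) →
      IsOpen U) (i : Fin 3) : IsOpenMap (S.crossing κ σ i) := by
  intro O hO
  refine htop _ (fun j => ?_) (fun j => ?_) (fun j => ?_)
  · have : S.sheet j ⁻¹' (S.crossing κ σ i '' O) = Subtype.val ⁻¹'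
        (κ '' (O ∩ {q | q.2 ≠ 0 ∧ (if q.2 ≤ 0 then i else σ i) = j})) := by
      ext x
      constructor
      · rintro ⟨q, hq, e⟩
        have e₁ : κ q = x := congrArg Prod.fst e
        exact ⟨q, ⟨hq, hoff q (e₁ ▸ x.2), congrArg Prod.snd e⟩, e₁⟩
      · rintro ⟨q, ⟨hq, _, e⟩, e₁⟩
        exact ⟨q, hq, Prod.ext e₁ e⟩
    rw [this]
    exact (hκ.isOpenMap _ (hO.inter (isOpen_crossing_snd σ i j))).preimage continuous_subtype_val
  · have : S.crossing κ σ j ⁻¹' (S.crossing κ σ i '' O) = {q | q ∈ O ∧ i = j} := by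
      ext q
      constructor
      · rintro ⟨q', hq', e⟩
        obtain ⟨rfl, rfl⟩ := crossing_injective hκ.injective e
        exact ⟨hq', rfl⟩
      · rintro ⟨hq, rfl⟩
        exact ⟨q, hq, rfl⟩
    rw [this]
    exact hO.and isOpen_const
  · have : S.crossing κ' σ' j ⁻¹' (S.crossing κ σ i '' O) = ∅ := by
      refine eq_empty_of_forall_notMem fun q hq => ?_
      obtain ⟨q', -, e⟩ := hq
      exact hκκ' _ _ (congrArg Prod.fst e)
    rw [this]
    exact isOpen_empty

theorem isOpenEmbedding_crossingC (h : S.IsRegular) (i : Fin 3) :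
    IsOpenEmbedding (S.crossing S.collarC (Equiv.swap 0 1) i) :=
  .of_continuous_injective_isOpenMap (S.continuous_crossingC i)
    (fun _ _ e => (crossing_injective h.embC.injective e).1)
    (isOpenMap_crossing h.embC h.disj (fun q => (collarC_mem_offCurves h q).1)
      (fun _ h₀ h₁ h₂ => isOpen_copies_iff.2 ⟨h₀, h₁, h₂⟩) i)

theorem isOpenEmbedding_crossingD (h : S.IsRegular) (i : Fin 3) :
    IsOpenEmbedding (S.crossing S.collarD (Equiv.swap 1 2) i) :=
  .of_continuous_injective_isOpenMap (S.continuous_crossingD i)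
    (fun _ _ e => (crossing_injective h.embD.injective e).1)
    (isOpenMap_crossing h.embD (fun q q' e => h.disj q' q e.symm)
      (fun q => (collarD_mem_offCurves h q).1)
      (fun _ h₀ h₁ h₂ => isOpen_copies_iff.2 ⟨h₀, h₂, h₁⟩) i)

theorem isOpen_preimage_crossing_sheet (h : S.IsRegular) {κ : Circle × ℝ → S.carrier}
    (hκ : Continuous κ) (hoff : ∀ q, κ q ∈ S.offCurves → q.2 ≠ 0) (σ : Equiv.Perm (Fin 3))
    (i j : Fin 3) {O : Set S.offCurves} (hO : IsOpen O) :
    IsOpen (S.crossing κ σ j ⁻¹' (S.sheet i '' O)) := by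
  have : S.crossing κ σ j ⁻¹' (S.sheet i '' O) =
      κ ⁻¹' (Subtype.val '' O) ∩ {q | q.2 ≠ 0 ∧ (if q.2 ≤ 0 then j else σ j) = i} := by
    ext q
    constructor
    · rintro ⟨x, hx, e⟩
      have e₁ : (x : S.carrier) = κ q := congrArg Prod.fst e
      exact ⟨⟨x, hx, e₁⟩, hoff q (e₁ ▸ x.2), (congrArg Prod.snd e).symm⟩
    · rintro ⟨⟨x, hx, e₁⟩, -, e⟩
      exact ⟨x, hx, Prod.ext e₁ e.symm⟩
  rw [this]
  exact ((h.isOpen_offCurves.isOpenMap_subtype_val _ hO).preimage hκ).inter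
    (isOpen_crossing_snd σ j i)

theorem isOpenEmbedding_sheet (h : S.IsRegular) (i : Fin 3) : IsOpenEmbedding (S.sheet i) := by
  refine .of_continuous_injective_isOpenMap (continuous_sheet i)
    (fun x y e => Subtype.ext (congrArg Prod.fst e)) fun O hO => ?_
  refine isOpen_copies_iff.2 ⟨fun j => ?_, fun j => ?_, fun j => ?_⟩
  · have : S.sheet j ⁻¹' (S.sheet i '' O) = {x | x ∈ O ∧ i = j} := by
      ext x
      constructor
      · rintro ⟨y, hy, e⟩
        have : y = x := Subtype.ext (congrArg Prod.fst e)
        exact ⟨this ▸ hy, congrArg Prod.snd e⟩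
      · rintro ⟨hx, rfl⟩
        exact ⟨x, hx, rfl⟩
    rw [this]
    exact hO.and isOpen_const
  · exact isOpen_preimage_crossing_sheet h S.contC (fun q => (collarC_mem_offCurves h q).1) _ _ _ hO
  · exact isOpen_preimage_crossing_sheet h S.contD (fun q => (collarD_mem_offCurves h q).1) _ _ _ hO

theorem mem_offCurves_or (S : MarkedSurface) (x : S.carrier) :
    x ∈ S.offCurves ∨ (∃ z, x = S.collarC (z, 0)) ∨ ∃ z, x = S.collarD (z, 0) := by
  by_contra! hx
  exact hx.1 fun z => ⟨hx.2.1 z, hx.2.2 z⟩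

theorem isEvenlyCovered_collar {κ : Circle × ℝ → S.carrier} (hκ : IsOpenEmbedding κ)
    {σ : Equiv.Perm (Fin 3)} (h : ∀ i, IsOpenEmbedding (S.crossing κ σ i)) (q : Circle × ℝ) :
    IsEvenlyCovered S.proj (κ q) (Fin 3) := by
  refine isEvenlyCovered_of_lifts S.continuous_proj hκ (s := S.crossing κ σ) h
    (fun i v => rfl) (fun i j v e => (crossing_injective hκ.injective e).2) ?_ q
  rintro ⟨y, j⟩ v hy
  by_cases hv : v.2 ≤ 0
  · exact ⟨j, Prod.ext hy.symm (if_pos hv)⟩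
  -- A crossing is numbered by its copy on the side `t ≤ 0`, so on the other side copy `j` belongs
  -- to the crossing `σ⁻¹ j`.
  · exact ⟨σ.symm j, Prod.ext hy.symm ((if_neg hv).trans (σ.apply_symm_apply j))⟩

theorem isCoveringMap_proj (h : S.IsRegular) : IsCoveringMap S.proj := by
  refine fun x => IsEvenlyCovered.to_isEvenlyCovered_preimage (I := Fin 3) ?_
  rcases S.mem_offCurves_or x with hx | ⟨z, rfl⟩ | ⟨z, rfl⟩
  · refine isEvenlyCovered_of_lifts S.continuous_proj h.isOpen_offCurves.isOpenEmbedding_subtypeVal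
      (s := S.sheet) (isOpenEmbedding_sheet h) (fun i v => rfl)
      (fun i j v e => congrArg Prod.snd e) ?_ (⟨x, hx⟩ : S.offCurves)
    rintro ⟨y, j⟩ v hy
    exact ⟨j, Prod.ext hy.symm rfl⟩
  · exact isEvenlyCovered_collar h.embC (isOpenEmbedding_crossingC h) _
  · exact isEvenlyCovered_collar h.embD (isOpenEmbedding_crossingD h) _

end MarkedSurface

/-! ### Inheritance of regularity, and the loop crossing one curve. -/

theorem Path.forall_trans {X : Type*} [TopologicalSpace X] {P : X → Prop} {a b c : X}
    {γ : Path a b} {γ' : Path b c} (h : ∀ t, P (γ t)) (h' : ∀ t, P (γ' t)) (t : unitInterval) :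
    P ((γ.trans γ') t) := by
  rw [Path.trans_apply]
  split_ifs
  exacts [h _, h' _]

/-- Used to see that a concatenation of lifts lifts the concatenation. -/
theorem Path.forall_trans_eq {X Y Z : Type*} [TopologicalSpace X] [TopologicalSpace Y]
    {f : X → Z} {g : Y → Z} {a b c : X} {a' b' c' : Y} {γ : Path a b} {γ' : Path b c}
    {δ : Path a' b'} {δ' : Path b' c'} (h : ∀ t, f (γ t) = g (δ t))
    (h' : ∀ t, f (γ' t) = g (δ' t)) (t : unitInterval) :
    f ((γ.trans γ') t) = g ((δ.trans δ') t) := by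
  rw [Path.trans_apply, Path.trans_apply]
  split_ifs
  exacts [h _, h' _]

namespace MarkedSurface
variable {S : MarkedSurface}

theorem triple_disjoint (h : S.IsRegular) (c d : Bool) (q q' : Circle × ℝ) :
    (S.triple c d).collarC q ≠ (S.triple c d).collarD q' :=
  fun e => h.disj q q' (congrArg Prod.fst e)

theorem sheet_mem_offCurves_triple (c d : Bool) (i : Fin 3) (x : S.offCurves) :
    (S.sheet i x : (S.triple c d).carrier) ∈ (S.triple c d).offCurves :=
  fun z => ⟨fun e => (x.2 z).1 (congrArg Prod.fst e), fun e => (x.2 z).2 (congrArg Prod.fst e)⟩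

theorem crossingC_mem_offCurves_triple (h : S.IsRegular) (c d : Bool) (i : Fin 3)
    (q : Circle × ℝ) :
    (S.crossing S.collarC (Equiv.swap 0 1) i q : (S.triple c d).carrier) ∈
      (S.triple c d).offCurves ↔ (i ≠ if c then 0 else 1) ∨ q.2 ≠ 0 := by
  constructor
  · intro hq
    by_contra! hi
    obtain ⟨rfl, hi⟩ := hi
    refine (hq q.1).1 ?_
    rw [← hi]
    rfl
  · refine fun hq z => ⟨fun e => ?_, fun e => h.disj _ _ (congrArg Prod.fst e)⟩
    obtain ⟨rfl, rfl⟩ := crossing_injective h.embC.injective e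
    simp at hq

theorem crossingD_mem_offCurves_triple (h : S.IsRegular) (c d : Bool) (i : Fin 3)
    (q : Circle × ℝ) :
    (S.crossing S.collarD (Equiv.swap 1 2) i q : (S.triple c d).carrier) ∈
      (S.triple c d).offCurves ↔ (i ≠ if d then 1 else 2) ∨ q.2 ≠ 0 := by
  constructor
  · intro hq
    by_contra! hi
    obtain ⟨rfl, hi⟩ := hi
    refine (hq q.1).2 ?_
    rw [← hi]
    rfl
  · refine fun hq z => ⟨fun e => h.disj _ _ (congrArg Prod.fst e).symm, fun e => ?_⟩
    obtain ⟨rfl, rfl⟩ := crossing_injective h.embD.injective e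
    simp at hq

theorem isOpen_offCurves_triple (h : S.IsRegular) (c d : Bool) :
    IsOpen ((S.triple c d).offCurves : Set S.Copies) := by
  refine isOpen_copies_iff.2 ⟨fun i => ?_, fun i => ?_, fun i => ?_⟩
  · convert isOpen_univ
    exact eq_univ_of_forall fun x => sheet_mem_offCurves_triple c d i x
  · have : S.crossing S.collarC (Equiv.swap 0 1) i ⁻¹' (S.triple c d).offCurves =
        {q | (i ≠ if c then 0 else 1) ∨ q.2 ≠ 0} :=
      Set.ext fun q => crossingC_mem_offCurves_triple h c d i q
    rw [this]
    exact IsOpen.union isOpen_const (isOpen_ne_fun continuous_snd continuous_const)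
  · have : S.crossing S.collarD (Equiv.swap 1 2) i ⁻¹' (S.triple c d).offCurves =
        {q | (i ≠ if d then 1 else 2) ∨ q.2 ≠ 0} :=
      Set.ext fun q => crossingD_mem_offCurves_triple h c d i q
    rw [this]
    exact IsOpen.union isOpen_const (isOpen_ne_fun continuous_snd continuous_const)

theorem joinedIn_sheet (h : S.IsRegular) (c d : Bool) (i : Fin 3) {x y : S.carrier}
    (hx : x ∈ S.offCurves) (hy : y ∈ S.offCurves) :
    JoinedIn ((S.triple c d).offCurves : Set S.Copies) (x, i) (y, i) := by
  have hpc : IsPathConnected (univ : Set S.offCurves) := by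
    rw [← pathConnectedSpace_iff_univ]
    exact isPathConnected_iff_pathConnectedSpace.1 h.isPathConnected_offCurves
  refine ((hpc.image (continuous_sheet i)).joinedIn _ ⟨⟨x, hx⟩, trivial, rfl⟩ _
    ⟨⟨y, hy⟩, trivial, rfl⟩).mono ?_
  rintro _ ⟨w, -, rfl⟩
  exact sheet_mem_offCurves_triple c d i w

theorem joinedIn_range_collar {Y : Type*} [TopologicalSpace Y] {κ : Circle × ℝ → Y}
    (hκ : Continuous κ) {A : Set Y} (z : Circle) (hA : ∀ t, κ (z, t) ∈ A) (t t' : ℝ) :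
    JoinedIn A (κ (z, t)) (κ (z, t')) := by
  refine ((isPathConnected_univ.image (f := fun t : ℝ => κ (z, t)) (by fun_prop)).joinedIn _
    ⟨t, trivial, rfl⟩ _ ⟨t', trivial, rfl⟩).mono ?_
  rintro _ ⟨w, -, rfl⟩
  exact hA w

/-- Each sheet is connected by hypothesis, and the unmarked lift of each curve leaves a passage
between `0` and `1`, respectively `1` and `2`. -/
theorem isPathConnected_offCurves_triple (h : S.IsRegular) (c d : Bool) :
    IsPathConnected ((S.triple c d).offCurves : Set S.Copies) := by
  obtain ⟨b, hb⟩ := h.isPathConnected_offCurves.nonempty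
  set A : Set S.Copies := (S.triple c d).offCurves with hA
  have hC : ∀ t : ℝ, t ≠ 0 → S.collarC (1, t) ∈ S.offCurves :=
    fun t ht => (collarC_mem_offCurves h _).2 ht
  have hD : ∀ t : ℝ, t ≠ 0 → S.collarD (1, t) ∈ S.offCurves :=
    fun t ht => (collarD_mem_offCurves h _).2 ht
  have jC : ∀ i : Fin 3, (i ≠ if c then 0 else 1) →
      JoinedIn A (b, i) (b, Equiv.swap 0 1 i) := by
    intro i hi
    have := joinedIn_range_collar (S.continuous_crossingC i) (A := A) 1
      (fun t => (crossingC_mem_offCurves_triple h c d i _).2 (Or.inl hi)) (-1) 1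
    have e₁ : S.crossing S.collarC (Equiv.swap 0 1) i (1, -1) = (S.collarC (1, -1), i) :=
      Prod.ext rfl (if_pos (by norm_num))
    have e₂ : S.crossing S.collarC (Equiv.swap 0 1) i (1, 1) =
        (S.collarC (1, 1), Equiv.swap 0 1 i) := Prod.ext rfl (if_neg (by norm_num))
    rw [e₁, e₂] at this
    exact ((joinedIn_sheet h c d i hb (hC _ (by norm_num))).trans this).trans
      (joinedIn_sheet h c d _ (hC _ (by norm_num)) hb)
  have jD : ∀ i : Fin 3, (i ≠ if d then 1 else 2) →
      JoinedIn A (b, i) (b, Equiv.swap 1 2 i) := by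
    intro i hi
    have := joinedIn_range_collar (S.continuous_crossingD i) (A := A) 1
      (fun t => (crossingD_mem_offCurves_triple h c d i _).2 (Or.inl hi)) (-1) 1
    have e₁ : S.crossing S.collarD (Equiv.swap 1 2) i (1, -1) = (S.collarD (1, -1), i) :=
      Prod.ext rfl (if_pos (by norm_num))
    have e₂ : S.crossing S.collarD (Equiv.swap 1 2) i (1, 1) =
        (S.collarD (1, 1), Equiv.swap 1 2 i) := Prod.ext rfl (if_neg (by norm_num))
    rw [e₁, e₂] at this
    exact ((joinedIn_sheet h c d i hb (hD _ (by norm_num))).trans this).trans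
      (joinedIn_sheet h c d _ (hD _ (by norm_num)) hb)
  have j01 : JoinedIn A (b, 1) (b, 0) := by
    cases c
    · exact (jC 0 (by decide)).symm
    · exact jC 1 (by decide)
  have j12 : JoinedIn A (b, 1) (b, 2) := by
    cases d
    · exact jD 1 (by decide)
    · exact (jD 2 (by decide)).symm
  have jb : ∀ i : Fin 3, JoinedIn A (b, 1) (b, i) := by
    intro i
    fin_cases i
    · exact j01
    · exact JoinedIn.refl j01.source_mem
    · exact j12
  have jo : ∀ (i : Fin 3) (x : S.carrier), x ∈ S.offCurves → JoinedIn A (b, 1) (x, i) :=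
    fun i x hx => (jb i).trans (joinedIn_sheet h c d i hb hx)
  refine ⟨(b, 1), j01.source_mem, ?_⟩
  rintro ⟨x, i⟩ hx
  -- A point on an unmarked lift is pushed to `t = -1`, which remains in copy `i` because the core
  -- is assigned to the side `t ≤ 0`.
  rcases S.mem_offCurves_or x with hx' | ⟨z, rfl⟩ | ⟨z, rfl⟩
  · exact jo i x hx'
  · have e₀ : S.crossing S.collarC (Equiv.swap 0 1) i (z, 0) = (S.collarC (z, 0), i) :=
      Prod.ext rfl (if_pos le_rfl)
    have e₁ : S.crossing S.collarC (Equiv.swap 0 1) i (z, -1) = (S.collarC (z, -1), i) :=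
      Prod.ext rfl (if_pos (by norm_num))
    have hi : i ≠ if c then 0 else 1 := by
      have := (crossingC_mem_offCurves_triple h c d i (z, 0)).1 (e₀ ▸ hx)
      simpa using this
    have := joinedIn_range_collar (S.continuous_crossingC i) (A := A) z
      (fun t => (crossingC_mem_offCurves_triple h c d i _).2 (Or.inl hi)) (-1) 0
    rw [e₀, e₁] at this
    exact (jo i _ ((collarC_mem_offCurves h _).2 (by norm_num))).trans this
  · have e₀ : S.crossing S.collarD (Equiv.swap 1 2) i (z, 0) = (S.collarD (z, 0), i) :=
      Prod.ext rfl (if_pos le_rfl)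
    have e₁ : S.crossing S.collarD (Equiv.swap 1 2) i (z, -1) = (S.collarD (z, -1), i) :=
      Prod.ext rfl (if_pos (by norm_num))
    have hi : i ≠ if d then 1 else 2 := by
      have := (crossingD_mem_offCurves_triple h c d i (z, 0)).1 (e₀ ▸ hx)
      simpa using this
    have := joinedIn_range_collar (S.continuous_crossingD i) (A := A) z
      (fun t => (crossingD_mem_offCurves_triple h c d i _).2 (Or.inl hi)) (-1) 0
    rw [e₀, e₁] at this
    exact (jo i _ ((collarD_mem_offCurves h _).2 (by norm_num))).trans this

theorem IsRegular.triple (h : S.IsRegular) (c d : Bool) : (S.triple c d).IsRegular where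
  embC := isOpenEmbedding_crossingC h _
  embD := isOpenEmbedding_crossingD h _
  disj := triple_disjoint h c d
  isOpen_offCurves := isOpen_offCurves_triple h c d
  isPathConnected_offCurves := isPathConnected_offCurves_triple h c d

theorem IsRegular.pathConnectedSpace (h : S.IsRegular) : PathConnectedSpace S.carrier := by
  obtain ⟨b, hb⟩ := h.isPathConnected_offCurves.nonempty
  have jo : ∀ x ∈ S.offCurves, Joined b x :=
    fun x hx => (h.isPathConnected_offCurves.joinedIn b hb x hx).joined
  suffices ∀ x, Joined b x from ⟨⟨b⟩, fun x y => (this x).symm.trans (this y)⟩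
  intro x
  rcases S.mem_offCurves_or x with hx | ⟨z, rfl⟩ | ⟨z, rfl⟩
  · exact jo x hx
  · exact (jo _ ((collarC_mem_offCurves h (z, -1)).2 (by norm_num))).trans
      (joinedIn_range_collar S.contC (A := univ) z (fun _ => trivial) (-1) 0).joined
  · exact (jo _ ((collarD_mem_offCurves h (z, -1)).2 (by norm_num))).trans
      (joinedIn_range_collar S.contD (A := univ) z (fun _ => trivial) (-1) 0).joined

/-- The point of copy `i` over a point of the surface. -/
def copy (S : MarkedSurface) (i : Fin 3) (x : S.carrier) : S.Copies := (x, i)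

/-- A loop that crosses the first curve once and avoids the second one: it lifts to a
closed loop in the sheet `2` and to a path from the sheet `0` to the sheet `1`. -/
theorem IsRegular.exists_crossing_loop (h : S.IsRegular) (c d : Bool) :
    ∃ (b : S.carrier) (β : Path (S.copy 2 b) (S.copy 2 b)) (ρ : Path (S.copy 0 b) (S.copy 1 b)),
      (∀ t, β t ∈ (S.triple c d).offCurves) ∧ ∀ t, S.proj (ρ t) = S.proj (β t) := by
  have h₁ : S.collarC (1, 1) ∈ S.offCurves := (collarC_mem_offCurves h _).2 (by norm_num)
  have h₀ : S.collarC (1, -1) ∈ S.offCurves := (collarC_mem_offCurves h _).2 (by norm_num)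
  have hpc := isPathConnected_iff_pathConnectedSpace.1 h.isPathConnected_offCurves
  obtain ⟨η⟩ := hpc.joined (⟨_, h₁⟩ : S.offCurves) ⟨_, h₀⟩
  obtain ⟨τ⟩ : Joined ((1, -1) : Circle × ℝ) (1, 1) := PathConnectedSpace.joined _ _
  have e₀ : ∀ i, S.copy i (S.collarC (1, -1)) =
      S.crossing S.collarC (Equiv.swap 0 1) i (1, -1) :=
    fun i => Prod.ext rfl (if_pos (by norm_num)).symm
  have e₁ : ∀ i, S.sheet (Equiv.swap 0 1 i) ⟨S.collarC (1, 1), h₁⟩ =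
      S.crossing S.collarC (Equiv.swap 0 1) i (1, 1) :=
    fun i => Prod.ext rfl (if_neg (by norm_num)).symm
  let L₁ : ∀ i : Fin 3, Path (S.copy i (S.collarC (1, -1)))
      (S.copy (Equiv.swap 0 1 i) (S.collarC (1, 1))) :=
    fun i => (τ.map (S.continuous_crossingC i)).cast (e₀ i) (e₁ i)
  let L₂ : ∀ i : Fin 3, Path (S.copy i (S.collarC (1, 1))) (S.copy i (S.collarC (1, -1))) :=
    fun i => η.map (continuous_sheet i)
  -- Cross the collar, then return through the complement. The swap fixes `2`, so `L 2` is closed,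
  -- and the lift it crosses is never marked, the marked one having index `0` or `1`; `L 0` ends in
  -- copy `1`.
  let L : ∀ i : Fin 3, Path (S.copy i (S.collarC (1, -1)))
      (S.copy (Equiv.swap 0 1 i) (S.collarC (1, -1))) := fun i => (L₁ i).trans (L₂ _)
  refine ⟨S.collarC (1, -1), L 2, L 0, fun t => ?_, fun t => ?_⟩
  · exact Path.forall_trans (P := (· ∈ (S.triple c d).offCurves))
      (fun t => (crossingC_mem_offCurves_triple h c d 2 _).2 (Or.inl (by cases c <;> decide)))
      (fun t => sheet_mem_offCurves_triple c d 2 _) t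
  · exact Path.forall_trans_eq (f := S.proj) (g := S.proj) (γ := L₁ 0) (γ' := L₂ 1) (δ := L₁ 2)
      (δ' := L₂ 2) (fun t => rfl) (fun t => rfl) t

/-- A lift of a path in the complement of the curves stays in one sheet. -/
theorem IsRegular.snd_lift_eq (h : S.IsRegular) {Γ : C(unitInterval, S.Copies)}
    (hΓ : ∀ t, S.proj (Γ t) ∈ S.offCurves) (t : unitInterval) : (Γ t).2 = (Γ 0).2 := by
  -- The competing lift that stays in the initial sheet; uniqueness of lifts identifies it with `Γ`.
  let Γ' : unitInterval → S.Copies := fun t => S.sheet (Γ 0).2 ⟨S.proj (Γ t), hΓ t⟩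
  have hc : Continuous Γ' := (continuous_sheet _).comp
    (Continuous.subtype_mk (S.continuous_proj.comp Γ.continuous) _)
  have := (isCoveringMap_proj h).eq_of_comp_eq Γ.continuous hc (funext fun t => rfl) 0 rfl
  exact congrArg (fun F : unitInterval → S.Copies => (F t).2) this

theorem mem_offCurves_triple_of_proj {c d : Bool} {x : S.Copies} (hx : S.proj x ∈ S.offCurves) :
    x ∈ (S.triple c d).offCurves :=
  sheet_mem_offCurves_triple c d x.2 ⟨S.proj x, hx⟩

end MarkedSurface

/-! ### A criterion for wild group chains. -/

namespace GroupChain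

variable {Γ : Type*} [Group Γ] {𝒢 : GroupChain Γ}

theorem core_le {n ℓ : ℕ} : 𝒢.core n ℓ ≤ 𝒢.grp ℓ := fun h hh => by
  simpa using (𝒢.mem_core.1 hh) 1 (one_mem _)

/-- A chain is not stable if for every `n` some element lies in all cores in `G_{n+1}` but not in
all cores in `G_n`. -/
theorem not_isStable_of_core
    (H : ∀ n, ∃ h : Γ, (∀ ℓ, n + 1 ≤ ℓ → h ∈ 𝒢.core (n + 1) ℓ) ∧ h ∉ 𝒢.core n (n + 1)) :
    ¬ 𝒢.IsStable := by
  rintro ⟨n, hn⟩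
  obtain ⟨h, h₁, h₂⟩ := H n
  have hmem : ∀ ℓ, h ∈ 𝒢.grp ℓ := fun ℓ =>
    𝒢.anti (le_max_left ℓ (n + 1)) (core_le (h₁ _ (le_max_right ℓ (n + 1))))
  -- The constant sequence `h` is the element of the kernel of `ψ_{n,n+1}`; its component at level
  -- `n + 1` shows that it is not trivial.
  let a : 𝒢.discriminant n :=
    ⟨fun ℓ => QuotientGroup.mk ⟨h, hmem ℓ⟩, fun ℓ => rfl⟩
  have ha : 𝒢.discriminantMap (Nat.le_succ n) a = 𝒢.discriminantMap (Nat.le_succ n) 1 := by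
    rw [map_one]
    refine Subtype.ext (funext fun ℓ => ?_)
    change (QuotientGroup.mk (⟨h, hmem ℓ⟩ : 𝒢.grp ℓ) : 𝒢.Quot (n + 1) ℓ) = 1
    rw [QuotientGroup.eq_one_iff, Subgroup.mem_subgroupOf]
    exact h₁ ℓ ℓ.2
  obtain ⟨k, hkn⟩ : ∃ k : {ℓ : ℕ // n ≤ ℓ}, (k : ℕ) = n + 1 := ⟨⟨n + 1, Nat.le_succ n⟩, rfl⟩
  have hk : (QuotientGroup.mk (⟨h, hmem k⟩ : 𝒢.grp k) : 𝒢.Quot n k) = 1 :=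
    congrArg (fun b : 𝒢.discriminant n => b.1 k) ((hn n (n + 1) le_rfl (Nat.le_succ n)).1 ha)
  rw [QuotientGroup.eq_one_iff, Subgroup.mem_subgroupOf] at hk
  exact h₂ (hkn ▸ hk)

end GroupChain

/-! ### Path lifting in towers of coverings, and wildness of the group chains. -/

namespace Tower

open unitInterval

variable {P : Tower}

theorem continuous_eval (k : ℕ) : Continuous fun y : P.Limit => y.1 k :=
  (continuous_apply k).comp continuous_subtype_val

theorem eval_eq_of_le {y y' : P.Limit} {k : ℕ} (h : y.1 k = y'.1 k) :
    ∀ {j : ℕ}, j ≤ k → y.1 j = y'.1 j := by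
  induction k with
  | zero =>
    intro j hj
    obtain rfl := Nat.le_zero.1 hj
    exact h
  | succ k ih =>
    intro j hj
    rcases Nat.le_succ_iff.1 hj with hj | rfl
    · exact ih (by rw [← y.2 k, ← y'.2 k, h]) hj
    · exact h

/-- Uniqueness of lifts is applied one level at a time, so `q k` itself need not be known to be a
covering. -/
theorem eq_of_q_comp_eq (cov : ∀ n, IsCoveringMap (P.p n)) :
    ∀ {k : ℕ} {f g : C(I, P.M k)}, (∀ t, P.q k (f t) = P.q k (g t)) → ∀ {s : I}, f s = g s → f = g
  | 0, _, _, h, _, _ => ContinuousMap.ext h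
  | k + 1, f, g, h, s, hs => by
    have := eq_of_q_comp_eq cov (k := k) (f := (⟨P.p k, P.cont k⟩ : C(_, _)).comp f)
      (g := (⟨P.p k, P.cont k⟩ : C(_, _)).comp g) h (s := s) (congrArg (P.p k) hs)
    exact DFunLike.coe_injective ((cov k).eq_of_comp_eq f.continuous g.continuous
      (congrArg (fun F : C(I, P.M k) => (F : I → P.M k)) this) s hs)

theorem homotopicRel_of_q_comp (cov : ∀ n, IsCoveringMap (P.p n)) :
    ∀ {k : ℕ} {f g : C(I, P.M k)}, ((P.q k).comp f).HomotopicRel ((P.q k).comp g) {0, 1} →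
      f 0 = g 0 → f.HomotopicRel g {0, 1}
  | 0, _, _, h, _ => h
  | k + 1, f, g, h, h0 =>
    ((cov k).homotopicRel_iff_comp (f₀ := f) (f₁ := g) (S := {0, 1}) ⟨0, Or.inl rfl, h0⟩).2
      (homotopicRel_of_q_comp cov (k := k) h (congrArg (P.p k) h0))

/-- A path in the inverse limit is determined at level `k` by its projection to the base. -/
theorem eval_eq_of_lifts (cov : ∀ n, IsCoveringMap (P.p n)) {k : ℕ} (Λ : C(I, P.Limit))
    (ω : C(I, P.M k)) (h : ∀ t, (Λ t).1 0 = P.q k (ω t)) {s : I} (hs : (Λ s).1 k = ω s) (t : I) :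
    (Λ t).1 k = ω t := by
  have := eq_of_q_comp_eq cov (f := ⟨fun t => (Λ t).1 k, (continuous_eval k).comp Λ.continuous⟩)
    (g := ω) (fun t => (P.q_apply (Λ t) k).trans (h t)) hs
  exact DFunLike.congr_fun this t

theorem eval_eq_of_eval_zero_eq (cov : ∀ n, IsCoveringMap (P.p n)) {k : ℕ} (Λ Λ' : C(I, P.Limit))
    (h : ∀ t, (Λ t).1 0 = (Λ' t).1 0) {s : I} (hs : (Λ s).1 k = (Λ' s).1 k) (t : I) :
    (Λ t).1 k = (Λ' t).1 k :=
  eval_eq_of_lifts cov Λ ⟨fun t => (Λ' t).1 k, (continuous_eval k).comp Λ'.continuous⟩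
    (fun t => (h t).trans (P.q_apply (Λ' t) k).symm) hs t

theorem exists_lift_zero (cov : ∀ n, IsCoveringMap (P.p n)) (γ : C(I, P.M 0)) (y : P.Limit)
    (h : γ 0 = y.1 0) : ∃ Λ : C(I, P.Limit), Λ 0 = y ∧ ∀ t, (Λ t).1 0 = γ t := by
  -- Each level lifts the path of the level below, starting at the coordinate of `y`; the coherent
  -- family is a path in the limit.
  let F : ∀ n, {Γ : C(I, P.M n) // Γ 0 = y.1 n} := fun n =>
    Nat.rec ⟨γ, h⟩ (fun n Γ => ⟨(cov n).liftPath Γ.1 (y.1 (n + 1)) (Γ.2.trans (y.2 n).symm),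
      (cov n).liftPath_zero ..⟩) n
  have hF : ∀ n t, P.p n ((F (n + 1)).1 t) = (F n).1 t := fun n t =>
    congrFun ((cov n).liftPath_lifts (F n).1 (y.1 (n + 1)) ((F n).2.trans (y.2 n).symm)) t
  refine ⟨⟨fun t => ⟨fun n => (F n).1 t, fun n => hF n t⟩, ?_⟩, ?_, fun t => rfl⟩
  · exact Continuous.subtype_mk (continuous_pi fun n => (F n).1.continuous) _
  · exact Subtype.ext (funext fun n => (F n).2)

/-- Paths in the surfaces of a tower of coverings lift to the inverse limit. -/
theorem exists_lift (cov : ∀ n, IsCoveringMap (P.p n)) {m : ℕ} {a b : P.M m} (ω : Path a b)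
    (y : P.Limit) (h : y.1 m = a) : ∃ (z : P.Limit) (Λ : Path y z), ∀ t, (Λ t).1 m = ω t := by
  -- Push `ω` down to the base and lift from there; unique lifting recovers `ω` at level `m`.
  obtain ⟨Λ, h0, hΛ⟩ := exists_lift_zero cov ((P.q m).comp ω.toContinuousMap) y (by
    simpa [← h] using P.q_apply y m)
  refine ⟨Λ 1, ⟨Λ, h0, rfl⟩, fun t => eval_eq_of_lifts cov Λ ω.toContinuousMap hΛ (s := 0) ?_ t⟩
  rw [h0, h]
  exact ω.source.symm

theorem eval_eq_of_lift_eq {m : ℕ} {Λ Λ' : C(I, P.Limit)}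
    (h : ∀ t, (Λ t).1 m = (Λ' t).1 m) (t : I) : (Λ t).1 0 = (Λ' t).1 0 :=
  eval_eq_of_le (h t) (Nat.zero_le m)

/-- Every stage carries, at every base point, a loop that lifts to closed loops in the limit,
but whose image in the previous stage has a lift that is not closed. -/
def HasTransientLoops (P : Tower) : Prop :=
  ∀ (n : ℕ) (x : P.Limit), ∃ ω : Path (x.1 (n + 1)) (x.1 (n + 1)),
    (∀ Λ : C(I, P.Limit), (∀ t, (Λ t).1 (n + 1) = ω t) → Λ 1 = Λ 0) ∧
    ∃ a b : P.M (n + 1), a ≠ b ∧ ∃ ρ : Path a b, ∀ t, P.p n (ρ t) = P.p n (ω t)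

section GroupChain

variable {x : P.Limit}

theorem mem_groupChain_of_loop {γ : Path (x.1 0) (x.1 0)} (Λ : Path x x)
    (h : ∀ t, (Λ t).1 0 = γ t) (ℓ : ℕ) :
    FundamentalGroup.fromPath (.mk γ) ∈ (P.groupChain x).grp ℓ := by
  refine ⟨FundamentalGroup.fromPath (.mk (Λ.map (continuous_eval ℓ))), ?_⟩
  rw [FundamentalGroup.mapOfEq_apply]
  refine congrArg Path.Homotopic.Quotient.mk (Path.ext (funext fun t => ?_))
  exact (P.q_apply (Λ t) ℓ).trans (h t)

theorem exists_loop_of_mem_groupChain {ℓ : ℕ} {g : FundamentalGroup (P.M 0) (x.1 0)}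
    (hg : g ∈ (P.groupChain x).grp ℓ) :
    ∃ (α : Path (x.1 ℓ) (x.1 ℓ)) (γ : Path (x.1 0) (x.1 0)),
      g = FundamentalGroup.fromPath (.mk γ) ∧ ∀ t, γ t = P.q ℓ (α t) := by
  obtain ⟨a, rfl⟩ := hg
  induction a using Quotient.inductionOn with
  | h α => exact ⟨α, (α.map (P.q ℓ).continuous).cast (P.q_apply x ℓ).symm (P.q_apply x ℓ).symm,
      FundamentalGroup.mapOfEq_apply _ _ _, fun t => rfl⟩

/-- `G_ℓ` fixes `x_ℓ` under monodromy: `γ` is homotopic to the image of a loop at `x_ℓ`, and the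
homotopy lifts with fixed endpoints. -/
theorem eval_eq_of_mem_groupChain (cov : ∀ n, IsCoveringMap (P.p n)) {ℓ : ℕ}
    {γ : Path (x.1 0) (x.1 0)}
    (hγ : FundamentalGroup.fromPath (.mk γ) ∈ (P.groupChain x).grp ℓ) {z : P.Limit}
    (Λ : Path x z) (h : ∀ t, (Λ t).1 0 = γ t) : z.1 ℓ = x.1 ℓ := by
  obtain ⟨α, γ', e, hα⟩ := exists_loop_of_mem_groupChain hγ
  have e' : γ.Homotopic γ' := Path.Homotopic.Quotient.eq.1 e
  have e₁ : (P.q ℓ).comp (Λ.map (continuous_eval ℓ)).toContinuousMap = γ.toContinuousMap :=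
    ContinuousMap.ext fun t => (P.q_apply (Λ t) ℓ).trans (h t)
  have e₂ : (P.q ℓ).comp α.toContinuousMap = γ'.toContinuousMap :=
    ContinuousMap.ext fun t => (hα t).symm
  have := homotopicRel_of_q_comp cov (f := (Λ.map (continuous_eval ℓ)).toContinuousMap)
    (g := α.toContinuousMap) (by rw [e₁, e₂]; exact e') (by simp)
  obtain ⟨F⟩ := this
  have h₁ := (F.eq_fst 0 (x := 1) (by simp)).symm.trans (F.eq_snd 0 (x := 1) (by simp))
  simpa using h₁

/-- The group chains of a tower with transient loops are wild. -/
theorem not_isStable_groupChain (cov : ∀ n, IsCoveringMap (P.p n))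
    (conn : ∀ n, PathConnectedSpace (P.M n)) (hP : P.HasTransientLoops) (x : P.Limit) :
    ¬ (P.groupChain x).IsStable := by
  refine GroupChain.not_isStable_of_core fun n => ?_
  obtain ⟨ω, hω, a, b, hab, ρ, hρ⟩ := hP n x
  let η : Path (x.1 0) (x.1 0) :=
    (ω.map (P.q (n + 1)).continuous).cast (P.q_apply x _).symm (P.q_apply x _).symm
  refine ⟨FundamentalGroup.fromPath (.mk η), fun ℓ _ => ?_, fun hη => ?_⟩
  · rw [GroupChain.mem_core]
    intro g hg
    obtain ⟨α, γ, rfl, hα⟩ := exists_loop_of_mem_groupChain hg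
    -- An element of `G_{n+1}` carries `x` to some `y` with the same coordinate at level `n + 1`;
    -- over it `ω` lifts to a loop, so the conjugate lifts to a loop at `x`.
    obtain ⟨y, A, hA⟩ := exists_lift cov α x rfl
    have hy : y.1 (n + 1) = x.1 (n + 1) := by simpa using hA 1
    obtain ⟨z, Ω, hΩ⟩ := exists_lift cov ω y hy
    obtain rfl : z = y := by simpa using hω Ω.toContinuousMap hΩ
    have h0 : ∀ {f : C(I, P.Limit)} {δ : C(I, P.M (n + 1))}, (∀ t, (f t).1 (n + 1) = δ t) →
        ∀ t, (f t).1 0 = P.q (n + 1) (δ t) := fun hf t => by rw [← hf, P.q_apply]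
    have hA0 : ∀ t, (A t).1 0 = γ t := fun t => by
      rw [hα]
      exact h0 (f := A.toContinuousMap) (δ := α.toContinuousMap) hA t
    -- Multiplication in `FundamentalGroup` reverses concatenation, so `g⁻¹ * h * g` is `γ`, then
    -- `η`, then `γ` backwards.
    refine mem_groupChain_of_loop (γ := γ.trans (η.trans γ.symm)) (A.trans (Ω.trans A.symm))
      (Path.forall_trans_eq (f := fun w : P.Limit => w.1 0) (g := id) hA0
        (Path.forall_trans_eq (f := fun w : P.Limit => w.1 0) (g := id)
          (h0 (f := Ω.toContinuousMap) (δ := ω.toContinuousMap) hΩ) fun t => ?_)) ℓ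
    exact hA0 (σ t)
  · have ha : P.p n a = x.1 n := by simpa [x.2 n] using hρ 0
    -- The image of `δ` in `M n` is a loop, since `a` lies over `x_n`; it gives the conjugator `γ`
    -- in `G_n`. The lift of the conjugate from `x` passes through `a` and then `b`.
    obtain ⟨δ⟩ := (conn (n + 1)).joined (x.1 (n + 1)) a
    let α : Path (x.1 n) (x.1 n) := (δ.map (P.cont n)).cast (x.2 n).symm ha.symm
    let γ : Path (x.1 0) (x.1 0) :=
      (α.map (P.q n).continuous).cast (P.q_apply x n).symm (P.q_apply x n).symm
    have hγ : FundamentalGroup.fromPath (.mk γ) ∈ (P.groupChain x).grp n := by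
      refine ⟨FundamentalGroup.fromPath (.mk α), ?_⟩
      rw [FundamentalGroup.mapOfEq_apply]
      rfl
    have hconj := GroupChain.mem_core _ |>.1 hη _ hγ
    obtain ⟨y, A, hA⟩ := exists_lift cov δ x rfl
    have hy : y.1 (n + 1) = a := by simpa using hA 1
    obtain ⟨z, R, hR⟩ := exists_lift cov ρ y hy
    have hz : z.1 (n + 1) = b := by simpa using hR 1
    have hz0 : z.1 0 = x.1 0 := by
      rw [← P.q_apply z (n + 1), hz, ← P.q_apply x (n + 1)]
      change P.q n (P.p n b) = P.q n (P.p n (x.1 (n + 1)))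
      exact congrArg _ (by simpa using hρ 1)
    obtain ⟨w, B, hB⟩ := exists_lift cov γ.symm z (m := 0) hz0
    have hA0 : ∀ t, (A t).1 0 = γ t := fun t => by
      rw [← P.q_apply (A t) (n + 1), hA]
      rfl
    have hR0 : ∀ t, (R t).1 0 = η t := fun t => by
      rw [← P.q_apply (R t) (n + 1), hR]
      exact congrArg (P.q n) (hρ t)
    have hw : w.1 (n + 1) = x.1 (n + 1) := by
      refine eval_eq_of_mem_groupChain cov (γ := γ.trans (η.trans γ.symm)) hconj
        (A.trans (R.trans B)) (Path.forall_trans_eq (f := fun w : P.Limit => w.1 0) (g := id) hA0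
        (Path.forall_trans_eq (f := fun w : P.Limit => w.1 0) (g := id) hR0 hB))
    -- `A` and the reverse of `B` both lift `γ` and agree at time `0` on level `n + 1`, hence also
    -- at time `1`, where they give `a` and `b`.
    have key := eval_eq_of_eval_zero_eq cov (k := n + 1) A.toContinuousMap B.symm.toContinuousMap
      (fun t => (hA0 t).trans (by simpa using (hB (σ t)).symm)) (s := 0) (by simpa using hw.symm) 1
    exact hab (by simpa [hy, hz] using key)

end GroupChain
end Tower

/-! ### The fibre as a Cantor space, and its monodromy. -/

namespace Tower

open unitInterval

variable {P : Tower} {x₀ : P.M 0}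

/-- The points of the fibre that agree with `y` up to level `n`. -/
def cylinder (y : P.Fiber x₀) (n : ℕ) : Set (P.Fiber x₀) := {y' | y'.1.1 n = y.1.1 n}

theorem mem_cylinder_self (y : P.Fiber x₀) (n : ℕ) : y ∈ cylinder y n := rfl

theorem cylinder_anti (y : P.Fiber x₀) {m n : ℕ} (h : m ≤ n) : cylinder y n ⊆ cylinder y m :=
  fun _ hy' => eval_eq_of_le hy' h

theorem continuous_fiber_eval (n : ℕ) : Continuous fun y : P.Fiber x₀ => y.1.1 n :=
  (continuous_eval n).comp continuous_subtype_val

/-- Local injectivity of the covering separates `y.1.1 (n + 1)` from the other points over `y.1.1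
n`. -/
theorem isOpen_cylinder (cov : ∀ n, IsCoveringMap (P.p n)) (y : P.Fiber x₀) :
    ∀ n, IsOpen (cylinder y n)
  | 0 => by
    convert isOpen_univ
    exact eq_univ_of_forall fun y' => y'.2.trans y.2.symm
  | n + 1 => by
    obtain ⟨O, hO, hy, hinj⟩ := (cov n).isLocalHomeomorph.isLocallyInjective (y.1.1 (n + 1))
    have : cylinder y (n + 1) = cylinder y n ∩ {y' | y'.1.1 (n + 1) ∈ O} := by
      ext y'
      refine ⟨fun h => ⟨cylinder_anti y (Nat.le_succ n) h, ?_⟩, fun h => hinj h.2 hy ?_⟩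
      · change y'.1.1 (n + 1) ∈ O
        rw [show y'.1.1 (n + 1) = y.1.1 (n + 1) from h]
        exact hy
      · rw [y'.1.2 n, y.1.2 n]
        exact h.1
    rw [this]
    exact (isOpen_cylinder cov y n).inter (hO.preimage (continuous_fiber_eval (n + 1)))

theorem isClopen_cylinder (cov : ∀ n, IsCoveringMap (P.p n)) (y : P.Fiber x₀) (n : ℕ) :
    IsClopen (cylinder y n) := by
  refine ⟨⟨isOpen_iff_forall_mem_open.2 fun y' hy' => ⟨cylinder y' n, fun w hw hw' => hy' ?_,
    isOpen_cylinder cov y' n, mem_cylinder_self y' n⟩⟩, isOpen_cylinder cov y n⟩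
  exact Eq.trans (Eq.symm hw) hw'

theorem exists_cylinder_subset {U : Set (P.Fiber x₀)} (hU : IsOpen U) {y : P.Fiber x₀}
    (hy : y ∈ U) : ∃ n, cylinder y n ⊆ U := by
  obtain ⟨V, hV, rfl⟩ := hU
  obtain ⟨W, hW, rfl⟩ := hV
  obtain ⟨J, u, hu, hsub⟩ := isOpen_pi_iff.1 hW _ hy
  refine ⟨J.sup id, fun y' hy' => hsub fun i hi => ?_⟩
  rw [show y'.1.1 i = y.1.1 i from eval_eq_of_le hy' (Finset.le_sup (f := id) hi)]
  exact (hu i hi).2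

theorem totallySeparatedSpace_fiber (cov : ∀ n, IsCoveringMap (P.p n)) :
    TotallySeparatedSpace (P.Fiber x₀) := by
  rw [totallySeparatedSpace_iff_exists_isClopen]
  intro y y' hne
  obtain ⟨n, hn⟩ : ∃ n, y'.1.1 n ≠ y.1.1 n := by
    by_contra! h
    exact hne (Subtype.ext (Subtype.ext (funext fun n => (h n).symm)))
  exact ⟨cylinder y n, isClopen_cylinder cov y n, mem_cylinder_self y n, hn⟩

section Cantor

-- Only a set-theoretic labelling of the sheets, with no continuity: over a fixed `x₀` the level `n`
-- depends on finitely many labels, which is continuity enough.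
variable (coord : ∀ n, P.M (n + 1) ≃ P.M n × Fin 3)

/-- The point of level `n` over `x₀` with given coordinates. -/
def point (x₀ : P.M 0) (a : ℕ → Fin 3) : ∀ n, P.M n
  | 0 => x₀
  | n + 1 => (coord n).symm (point x₀ a n, a n)

theorem isLocallyConstant_point : ∀ n, IsLocallyConstant fun a => point coord x₀ a n
  | 0 => IsLocallyConstant.const _
  | n + 1 => ((isLocallyConstant_point n).prodMk
      ((IsLocallyConstant.iff_continuous _).2 (continuous_apply n))).comp (coord n).symm

theorem point_congr {a a' : ℕ → Fin 3} : ∀ {n : ℕ}, (∀ i < n, a i = a' i) →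
    point coord x₀ a n = point coord x₀ a' n
  | 0, _ => rfl
  | n + 1, h => by
    rw [point, point, point_congr fun i hi => h i (hi.trans n.lt_succ_self), h n n.lt_succ_self]

variable {coord} (hcoord : ∀ n x, (coord n x).1 = P.p n x)
include hcoord

/-- The fibre of the limit is homeomorphic to the space of sequences of sheets. -/
def fiberHomeo (cov : ∀ n, IsCoveringMap (P.p n)) (x₀ : P.M 0) : (ℕ → Fin 3) ≃ₜ P.Fiber x₀ := by
  have := totallySeparatedSpace_fiber (x₀ := x₀) cov
  let F : (ℕ → Fin 3) → P.Fiber x₀ := fun a =>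
    ⟨⟨point coord x₀ a, fun n => by rw [← hcoord, point, Equiv.apply_symm_apply]⟩, rfl⟩
  have hF : Continuous F := Continuous.subtype_mk (Continuous.subtype_mk
    (continuous_pi fun n => (isLocallyConstant_point coord n).continuous) _) _
  refine Continuous.homeoOfEquivCompactToT2 (f := Equiv.ofBijective F ⟨fun a a' h => ?_,
    fun y => ⟨fun n => (coord n (y.1.1 (n + 1))).2, ?_⟩⟩) hF
  · funext n
    have h₁ : point coord x₀ a (n + 1) = point coord x₀ a' (n + 1) :=
      congrArg (fun y : P.Fiber x₀ => y.1.1 (n + 1)) h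
    exact (Prod.ext_iff.1 ((coord n).symm.injective h₁)).2
  · refine Subtype.ext (Subtype.ext (funext fun n => ?_))
    change point coord x₀ _ n = y.1.1 n
    induction n with
    | zero => exact y.2.symm
    | succ n ih =>
      rw [point, ih, Equiv.symm_apply_eq]
      exact Prod.ext ((y.1.2 n).symm.trans (hcoord _ _).symm) rfl

theorem isCantorSpace_fiber (cov : ∀ n, IsCoveringMap (P.p n)) (x₀ : P.M 0) :
    IsCantorSpace (P.Fiber x₀) := by
  have := totallySeparatedSpace_fiber (x₀ := x₀) cov
  let e := fiberHomeo hcoord cov x₀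
  refine ⟨⟨e fun _ => 0⟩, e.compactSpace, e.symm.isEmbedding.metrizableSpace, inferInstance, ?_⟩
  rw [perfectSpace_iff_forall_not_isolated]
  intro y
  refine mem_closure_iff_nhdsWithin_neBot.1 (mem_closure_iff.2 fun U hU hy => ?_)
  obtain ⟨n, hn⟩ := exists_cylinder_subset hU hy
  obtain ⟨a, rfl⟩ := e.surjective y
  -- Level `n` depends only on the labels with index below `n`, so changing label `n` stays in the
  -- cylinder.
  refine ⟨e (Function.update a n (a n + 1)), hn ?_, fun h => ?_⟩
  · exact point_congr coord fun i hi => Function.update_of_ne hi.ne _ _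
  · have := congrFun (e.injective h) n
    simp at this

end Cantor

/-- By compactness, agreement at one sufficiently high level forces a pair into `N`, and the action
preserves such agreement. -/
theorem isEquicontinuousAction_of_level [CompactSpace (P.Fiber x₀)]
    (cov : ∀ n, IsCoveringMap (P.p n)) {H : Subgroup (P.Fiber x₀ ≃ₜ P.Fiber x₀)}
    (hH : ∀ g ∈ H, ∀ (w w' : P.Fiber x₀) (k : ℕ), w.1.1 k = w'.1.1 k →
      (g w).1.1 k = (g w').1.1 k) : IsEquicontinuousAction H := by
  intro N hN
  have h₁ : ∀ y : P.Fiber x₀, ∃ n, cylinder y n ×ˢ cylinder y n ⊆ N := by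
    intro y
    have hy : N ∈ 𝓝 (y, y) := mem_nhdsSet_iff_forall.1 hN (y, y) rfl
    obtain ⟨U, V, hU, hyU, hV, hyV, h⟩ := mem_nhds_prod_iff'.1 hy
    obtain ⟨n, hn⟩ := exists_cylinder_subset hU hyU
    obtain ⟨m, hm⟩ := exists_cylinder_subset hV hyV
    refine ⟨max n m, fun w hw => h ⟨hn ?_, hm ?_⟩⟩
    · exact cylinder_anti y (le_max_left n m) hw.1
    · exact cylinder_anti y (le_max_right n m) hw.2
  choose n hn using h₁
  obtain ⟨s, hs⟩ := isCompact_univ.elim_finite_subcover (fun y => cylinder y (n y))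
    (fun y => isOpen_cylinder cov y _) fun y _ => mem_iUnion.2 ⟨y, mem_cylinder_self y _⟩
  refine ⟨{w | w.1.1.1 (s.sup n) = w.2.1.1 (s.sup n)}, ?_, fun g hg w w' hw => ?_⟩
  · rw [mem_nhdsSet_iff_forall]
    rintro ⟨y, y'⟩ hyy'
    obtain rfl : y = y' := hyy'
    refine Filter.mem_of_superset (prod_mem_nhds
      ((isOpen_cylinder cov y (s.sup n)).mem_nhds (mem_cylinder_self y _))
      ((isOpen_cylinder cov y (s.sup n)).mem_nhds (mem_cylinder_self y _))) fun w hw => ?_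
    exact Eq.trans hw.1 (Eq.symm hw.2)
  · obtain ⟨y, hy, hgw⟩ := mem_iUnion₂.1 (hs (mem_univ (g w)))
    refine hn y ⟨hgw, ?_⟩
    exact (eval_eq_of_le (hH g hg w w' _ hw) (Finset.le_sup (f := n) hy)).symm.trans hgw

theorem monodromy_level (cov : ∀ n, IsCoveringMap (P.p n)) {g : P.Fiber x₀ ≃ₜ P.Fiber x₀}
    (hg : g ∈ P.monodromyGroup x₀) (w w' : P.Fiber x₀) (k : ℕ) (h : w.1.1 k = w'.1.1 k) :
    (g w).1.1 k = (g w').1.1 k := by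
  obtain ⟨γ, hγ⟩ := hg
  obtain ⟨Λ, hΛ⟩ := hγ w
  obtain ⟨Λ', hΛ'⟩ := hγ w'
  simpa using eval_eq_of_eval_zero_eq cov (k := k) Λ.toContinuousMap Λ'.toContinuousMap
    (fun t => (hΛ t).trans (hΛ' t).symm) (s := 0) (by simpa using h) 1

/-- Transport along the leaves over a loop. -/
theorem exists_transport (cov : ∀ n, IsCoveringMap (P.p n)) (γ : Path x₀ x₀) :
    ∃ h : P.Fiber x₀ ≃ₜ P.Fiber x₀, ∀ y : P.Fiber x₀,
      ∃ Λ : Path (y : P.Limit) (h y : P.Limit), ∀ t, (Λ t).1 0 = γ t := by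
  choose z Λ hΛ using fun (γ : Path x₀ x₀) (y : P.Fiber x₀) => exists_lift cov γ y.1 (m := 0) y.2
  let T : Path x₀ x₀ → P.Fiber x₀ → P.Fiber x₀ := fun γ y => ⟨z γ y, by simpa using hΛ γ y 1⟩
  have hT : ∀ γ y, T γ.symm (T γ y) = y := by
    intro γ y
    refine Subtype.ext (Subtype.ext (funext fun k => ?_))
    have := eval_eq_of_eval_zero_eq cov (k := k) (Λ γ.symm (T γ y)).toContinuousMap
      (Λ γ y).symm.toContinuousMap
      (fun t => (hΛ γ.symm _ t).trans (by simpa using (hΛ γ y (σ t)).symm)) (s := 0)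
      (by simp [T]) 1
    simpa using this
  -- Level `k` of the transported point depends only on level `k` of the point, by unique lifting.
  have hc : ∀ γ, Continuous (T γ) := by
    intro γ
    refine Continuous.subtype_mk (Continuous.subtype_mk (continuous_pi fun k => ?_) _) _
    refine IsLocallyConstant.continuous ((IsLocallyConstant.iff_exists_open _).2 fun y =>
      ⟨cylinder y k, isOpen_cylinder cov y k, mem_cylinder_self y k, fun y' hy' => ?_⟩)
    simpa using eval_eq_of_eval_zero_eq cov (k := k) (Λ γ y').toContinuousMap
      (Λ γ y).toContinuousMap (fun t => (hΛ γ y' t).trans (hΛ γ y t).symm) (s := 0)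
      (by simpa using (show y'.1.1 k = y.1.1 k from hy')) 1
  exact ⟨⟨⟨T γ, T γ.symm, hT γ, fun y => by simpa using hT γ.symm y⟩, hc γ, hc γ.symm⟩,
    fun y => ⟨Λ γ y, hΛ γ y⟩⟩

/-- The monodromy permutes the cylinders of a given level, so an element sending one point of a
cylinder into it preserves the whole cylinder. -/
theorem isAdapted_cylinder (cov : ∀ n, IsCoveringMap (P.p n)) (y : P.Fiber x₀) (n : ℕ) :
    IsAdapted (P.monodromyGroup x₀) (cylinder y n) := by
  refine ⟨isClopen_cylinder cov y n, ⟨y, mem_cylinder_self y n⟩, fun g hg W _ hWV hW => ?_⟩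
  rcases W.eq_empty_or_nonempty with rfl | ⟨w, hw⟩
  · exact ⟨1, one_mem _, fun u hu => hu.elim⟩
  · have key : ∀ v, v ∈ cylinder y n ↔ g v ∈ cylinder y n := by
      intro v
      have h₁ : w.1.1 n = y.1.1 n := hWV hw
      have h₂ : (g w).1.1 n = y.1.1 n := hW hw
      constructor
      · intro hv
        exact (monodromy_level cov hg v w n (Eq.trans hv h₁.symm)).trans h₂
      · intro hv
        have := monodromy_level cov (inv_mem hg) (g v) (g w) n (Eq.trans hv h₂.symm)
        change (g.symm (g v)).1.1 n = (g.symm (g w)).1.1 n at this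
        rw [g.symm_apply_apply, g.symm_apply_apply] at this
        exact this.trans h₁
    exact ⟨g.subtype key, ⟨g, hg, fun u => rfl⟩, fun u _ => rfl⟩

/-- The monodromy of a tower with transient loops is not stable. -/
theorem not_isStableAction_monodromyGroup (cov : ∀ n, IsCoveringMap (P.p n))
    (conn : ∀ n, PathConnectedSpace (P.M n)) (hP : P.HasTransientLoops) (x : P.Fiber x₀) :
    ¬ IsStableAction (P.monodromyGroup x₀) := by
  intro hstable
  obtain ⟨U, hU, hxU, hUV⟩ := hstable x
  obtain ⟨n, hn⟩ := exists_cylinder_subset hU.1.isOpen hxU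
  obtain ⟨ω, hω, a, b, hab, ρ, hρ⟩ := hP n x.1
  have hq : P.q (n + 1) (x.1.1 (n + 1)) = x₀ := (P.q_apply x.1 (n + 1)).trans x.2
  obtain ⟨h, hh⟩ := exists_transport cov
    ((ω.map (P.q (n + 1)).continuous).cast hq.symm hq.symm)
  have hmem : h ∈ P.monodromyGroup x₀ := ⟨_, hh⟩
  have hfix : ∀ y ∈ cylinder x (n + 1), h y = y := by
    intro y hy
    obtain ⟨Λ, hΛ⟩ := hh y
    have := hω Λ.toContinuousMap (eval_eq_of_lifts cov Λ.toContinuousMap ω.toContinuousMap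
      hΛ (s := 0) (by simpa using (show y.1.1 (n + 1) = x.1.1 (n + 1) from hy)))
    exact Subtype.ext (by simpa using this)
  have hlev : ∀ y ∈ cylinder x n, h y ∈ cylinder x n := fun y hy =>
    (monodromy_level cov hmem y x n hy).trans (by rw [hfix x (mem_cylinder_self x _)])
  have ha : P.p n a = x.1.1 n := by simpa [x.1.2 n] using hρ 0
  obtain ⟨δ⟩ := (conn (n + 1)).joined (x.1.1 (n + 1)) a
  obtain ⟨y, A, hA⟩ := exists_lift cov δ x.1 rfl
  have hy : y.1 (n + 1) = a := by simpa using hA 1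
  have hyn : y.1 n = x.1.1 n := by rw [← y.2, hy, ha]
  -- A point of `cylinder x n` sitting at `a` on level `n + 1`, which `h` moves to `b`.
  let y' : P.Fiber x₀ := ⟨y, (eval_eq_of_le hyn (Nat.zero_le n)).trans x.2⟩
  have hmove : h y' ≠ y' := by
    intro e
    obtain ⟨Λ, hΛ⟩ := hh y'
    have := eval_eq_of_lifts cov Λ.toContinuousMap ρ.toContinuousMap
      (fun t => (hΛ t).trans (congrArg (P.q n) (hρ t)).symm) (s := 0) (by simpa using hy) 1
    have hb : (h y').1.1 (n + 1) = b := by simpa using this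
    exact hab (hy.symm.trans ((congrArg (fun w : P.Fiber x₀ => w.1.1 (n + 1)) e).symm.trans hb))
  -- `h` need not preserve `U`; adaptedness replaces it by an `f` acting on `U` that agrees with it
  -- on `cylinder x n`.
  obtain ⟨f, hf, hfh⟩ := hU.2.2 h hmem (cylinder x n) (isOpen_cylinder cov x n) hn
    fun y hy => hn (hlev y hy)
  have hVU := (cylinder_anti x (Nat.le_succ n)).trans hn
  have hfV : ∀ u : U, (u : P.Fiber x₀) ∈ cylinder x (n + 1) → f u = u := fun u hu =>
    Subtype.ext ((hfh u (cylinder_anti x (Nat.le_succ n) hu)).trans (hfix u hu))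
  have hstab : f ∈ inducedStabilizer (P.monodromyGroup x₀) U (cylinder x (n + 1)) := by
    refine ⟨hf, ?_⟩
    ext u
    constructor
    · rintro ⟨v, hv, rfl⟩
      rw [hfV v hv]
      exact hv
    · exact fun hu => ⟨u, hu, hfV u hu⟩
  have hrefl := hUV _ hVU (isAdapted_cylinder cov x (n + 1)) f
    (subset_closure ⟨f, hstab, rfl⟩) hfV
  have := hfh ⟨y', hn hyn⟩ hyn
  rw [hrefl] at this
  exact hmove this.symm

theorem isWildAction_monodromyGroup (cov : ∀ n, IsCoveringMap (P.p n))
    (conn : ∀ n, PathConnectedSpace (P.M n)) {coord : ∀ n, P.M (n + 1) ≃ P.M n × Fin 3}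
    (hcoord : ∀ n x, (coord n x).1 = P.p n x) (hP : P.HasTransientLoops) (x₀ : P.M 0) :
    IsWildAction (P.monodromyGroup x₀) := by
  have hC := isCantorSpace_fiber hcoord cov x₀
  have := hC.2.1
  obtain ⟨x⟩ := hC.1
  exact ⟨hC, isEquicontinuousAction_of_level cov fun g hg => monodromy_level cov hg,
    not_isStableAction_monodromyGroup cov conn hP x⟩

end Tower

/-! ### Regularity of the marked genus two surface. -/

theorem halfCircle_re (t : ℝ) : (halfCircle t : ℂ).re = -Real.cos (Real.arctan t) := by
  simpa [halfCircle] using Complex.exp_ofReal_mul_I_re (Real.arctan t)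

theorem halfCircle_im (t : ℝ) : (halfCircle t : ℂ).im = -Real.sin (Real.arctan t) := by
  simpa [halfCircle] using Complex.exp_ofReal_mul_I_im (Real.arctan t)

theorem Circle.re_sq_add_im_sq (z : Circle) : (z : ℂ).re ^ 2 + (z : ℂ).im ^ 2 = 1 := by
  have := Circle.normSq_coe z
  rw [Complex.normSq_apply] at this
  nlinarith

theorem Circle.ext_re_im {z w : Circle} (h : (z : ℂ).re = (w : ℂ).re)
    (h' : (z : ℂ).im = (w : ℂ).im) : z = w :=
  Circle.ext (Complex.ext h h')

theorem Circle.re_le_one (z : Circle) : (z : ℂ).re ≤ 1 := by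
  nlinarith [Circle.re_sq_add_im_sq z, sq_nonneg (z : ℂ).im]

/-- The collar parameter of a point of the open half circle `Re z < 0`. -/
theorem halfCircle_im_div_re (t : ℝ) : (halfCircle t : ℂ).im / (halfCircle t : ℂ).re = t := by
  rw [halfCircle_re, halfCircle_im, neg_div_neg_eq, ← Real.tan_eq_sin_div_cos, Real.tan_arctan]

theorem halfCircle_of_re_neg {z : Circle} (hz : (z : ℂ).re < 0) :
    halfCircle ((z : ℂ).im / (z : ℂ).re) = z := by
  have h1 := Circle.re_sq_add_im_sq z
  have hs : √(1 + ((z : ℂ).im / (z : ℂ).re) ^ 2) = -1 / (z : ℂ).re := by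
    rw [Real.sqrt_eq_iff_mul_self_eq (by positivity) (div_nonneg_of_nonpos (by norm_num) hz.le)]
    have := hz.ne
    field_simp
    linarith
  have := hz.ne
  refine Circle.ext_re_im ?_ ?_
  · rw [halfCircle_re, Real.cos_arctan, hs]
    field_simp
  · rw [halfCircle_im, Real.sin_arctan, hs]
    field_simp

theorem genusTwoCollar_re_neg (ε : ℝ) (hε : ε ^ 2 = 1) (q : Circle × ℝ) :
    ((genusTwoCollar ε hε q).1.1 : ℂ).re < 0 := by
  change (halfCircle q.2 : ℂ).re < 0
  rw [halfCircle_re]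
  linarith [Real.cos_arctan_pos q.2]

theorem genusTwoCollar_pos (ε : ℝ) (hε : ε ^ 2 = 1) (q : Circle × ℝ) :
    0 < ε * (genusTwoCollar ε hε q).1.2.2 := by
  change 0 < ε * (ε * √(1 - (halfCircle q.2 : ℂ).re - (q.1 : ℂ).re))
  rw [← mul_assoc, ← sq, hε, one_mul]
  refine Real.sqrt_pos.2 ?_
  have h := genusTwoCollar_re_neg ε hε q
  change (halfCircle q.2 : ℂ).re < 0 at h
  linarith [Circle.re_le_one q.1]

theorem genusTwoCollar_of_mem (ε : ℝ) (hε : ε ^ 2 = 1) {v : GenusTwo}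
    (hv : (v.1.1 : ℂ).re < 0) (hv' : 0 < ε * v.1.2.2) :
    genusTwoCollar ε hε (v.1.2.1, (v.1.1 : ℂ).im / (v.1.1 : ℂ).re) = v := by
  refine Subtype.ext (Prod.ext (halfCircle_of_re_neg hv) (Prod.ext rfl ?_))
  change ε * √(1 - (halfCircle ((v.1.1 : ℂ).im / (v.1.1 : ℂ).re) : ℂ).re - (v.1.2.1 : ℂ).re) =
    v.1.2.2
  have h₁ : v.1.2.2 ^ 2 = (ε * v.1.2.2) ^ 2 := by rw [mul_pow, hε, one_mul]
  rw [halfCircle_of_re_neg hv, ← v.2, h₁, Real.sqrt_sq hv'.le, ← mul_assoc, ← sq, hε, one_mul]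

/-- The image is the open set `Re z < 0`, `ε s > 0`, on which the inverse reads off `w` and `t = Im
z / Re z`. -/
theorem isOpenEmbedding_genusTwoCollar (ε : ℝ) (hε : ε ^ 2 = 1) :
    IsOpenEmbedding (genusTwoCollar ε hε) := by
  let g : GenusTwo → Circle × ℝ := fun v => (v.1.2.1, (v.1.1 : ℂ).im / (v.1.1 : ℂ).re)
  have hg : ∀ q, g (genusTwoCollar ε hε q) = q := fun q =>
    Prod.ext rfl (halfCircle_im_div_re q.2)
  have hc : Continuous fun v : GenusTwo => (v.1.1 : ℂ) := by fun_prop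
  have hV : IsOpen {v : GenusTwo | (v.1.1 : ℂ).re < 0 ∧ 0 < ε * v.1.2.2} :=
    (isOpen_lt (Complex.continuous_re.comp hc) continuous_const).inter
      (isOpen_lt continuous_const (continuous_const.mul
        (continuous_snd.comp (continuous_snd.comp continuous_subtype_val))))
  have hgc : ContinuousOn g {v : GenusTwo | (v.1.1 : ℂ).re < 0 ∧ 0 < ε * v.1.2.2} := by
    refine ContinuousOn.prodMk (by fun_prop) (ContinuousOn.div
      (Complex.continuous_im.comp hc).continuousOn (Complex.continuous_re.comp hc).continuousOn
      fun v hv => hv.1.ne)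
  refine .of_continuous_injective_isOpenMap (continuous_genusTwoCollar ε hε)
    (Function.LeftInverse.injective hg) fun O hO => ?_
  have : genusTwoCollar ε hε '' O =
      {v : GenusTwo | (v.1.1 : ℂ).re < 0 ∧ 0 < ε * v.1.2.2} ∩ g ⁻¹' O := by
    ext v
    constructor
    · rintro ⟨q, hq, rfl⟩
      exact ⟨⟨genusTwoCollar_re_neg ε hε q, genusTwoCollar_pos ε hε q⟩, by
        rw [mem_preimage, hg]
        exact hq⟩
    · rintro ⟨hv, hv'⟩
      exact ⟨g v, hv', genusTwoCollar_of_mem ε hε hv.1 hv.2⟩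
  rw [this]
  exact hgc.isOpen_inter_preimage hV hO

/-- Where `z = -1`, the equation gives `s² = 2 - Re w ≥ 1`, so `s ≠ 0` and its sign selects one of
the two curves. -/
theorem markedGenusTwo_offCurves :
    markedGenusTwo.offCurves = {v : GenusTwo | v.1.1 ≠ -1} := by
  have h0 : halfCircle 0 = -1 := by simp [halfCircle]
  ext v
  constructor
  · intro hv hz
    have hre : (v.1.1 : ℂ).re < 0 := by rw [hz]; simp
    have him : (v.1.1 : ℂ).im / (v.1.1 : ℂ).re = 0 := by rw [hz]; simp
    have hs : v.1.2.2 ≠ 0 := by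
      intro h
      have h2 := v.2
      rw [h, hz] at h2
      have := Circle.re_le_one v.1.2.1
      simp at h2
      linarith
    rcases hs.lt_or_gt with hs | hs
    · refine (hv v.1.2.1).2 ?_
      have := genusTwoCollar_of_mem (-1) (by norm_num) hre (by linarith)
      rw [him] at this
      exact this.symm
    · refine (hv v.1.2.1).1 ?_
      have := genusTwoCollar_of_mem 1 (by norm_num) hre (by linarith)
      rw [him] at this
      exact this.symm
  · intro hv z
    refine ⟨fun h => hv ?_, fun h => hv ?_⟩
    · rw [h]; exact h0
    · rw [h]; exact h0

/-- The point of the handle `ε s ≥ 0` with the given angles. -/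
def genusTwoPoint (ε : ℝ) (hε : ε ^ 2 = 1) (θ φ : ℝ) (h : Real.cos θ + Real.cos φ ≤ 1) :
    GenusTwo :=
  ⟨(Circle.exp θ, Circle.exp φ, ε * √(1 - Real.cos θ - Real.cos φ)), by
    have h₁ : ∀ θ : ℝ, (Circle.exp θ : ℂ).re = Real.cos θ := fun θ => by
      simp
    change (ε * √(1 - Real.cos θ - Real.cos φ)) ^ 2 = _
    rw [mul_pow, hε, one_mul, Real.sq_sqrt (by linarith)]
    simp only [h₁]⟩

theorem joinedIn_genusTwoPoint (ε : ℝ) (hε : ε ^ 2 = 1) {θ φ θ' φ' : ℝ}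
    (h : Real.cos θ + Real.cos φ ≤ 1) (h' : Real.cos θ' + Real.cos φ' ≤ 1) {K : Set (ℝ × ℝ)}
    (hK : IsPathConnected K) (hθ : (θ, φ) ∈ K) (hθ' : (θ', φ') ∈ K)
    (hle : ∀ x ∈ K, Real.cos x.1 + Real.cos x.2 ≤ 1)
    (hne : ∀ x ∈ K, Circle.exp x.1 ≠ -1) :
    JoinedIn {v : GenusTwo | v.1.1 ≠ -1} (genusTwoPoint ε hε θ φ h)
      (genusTwoPoint ε hε θ' φ' h') := by
  have hKc := isPathConnected_iff_pathConnectedSpace.1 hK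
  let F : K → GenusTwo := fun x => genusTwoPoint ε hε x.1.1 x.1.2 (hle x x.2)
  have hF : Continuous F := Continuous.subtype_mk (by fun_prop) _
  refine ((isPathConnected_univ.image hF).joinedIn _ ⟨⟨_, hθ⟩, trivial, rfl⟩ _
    ⟨⟨_, hθ'⟩, trivial, rfl⟩).mono ?_
  rintro _ ⟨x, -, rfl⟩
  exact hne x x.2


theorem Circle.exp_pi : Circle.exp Real.pi = -1 :=
  Circle.ext (by simp)

theorem Circle.exp_ne_neg_one {θ : ℝ} (h : |θ| < Real.pi) : Circle.exp θ ≠ -1 := by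
  intro e
  have h₁ : Real.cos θ = -1 := by
    have := congrArg (fun z : Circle => (z : ℂ).re) e
    simpa using this
  have := Real.cos_lt_cos_of_nonneg_of_le_pi (abs_nonneg θ) le_rfl h
  rw [Real.cos_pi, Real.cos_abs, h₁] at this
  exact lt_irrefl _ this

/-- Move `φ` to `π`, which only lowers `cos φ`; then every `θ` is allowed, so move `θ` to `0`;
finally move `φ` to `π / 2`. The endpoint has `s = 0`, on the circle common to both handles. -/
theorem joinedIn_genusTwoPoint_base (ε : ℝ) (hε : ε ^ 2 = 1) {θ φ : ℝ} (hθ : |θ| < Real.pi)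
    (hφ : |φ - Real.pi| ≤ Real.pi) (h : Real.cos θ + Real.cos φ ≤ 1) :
    JoinedIn {v : GenusTwo | v.1.1 ≠ -1} (genusTwoPoint ε hε θ φ h)
      (genusTwoPoint ε hε 0 (Real.pi / 2) (by simp)) := by
  have hball : ∀ x y : ℝ, IsPathConnected (Metric.closedBall x |y|) := fun x y =>
    (convex_closedBall x |y|).isPathConnected ⟨x, Metric.mem_closedBall_self (abs_nonneg y)⟩
  have hsingle : ∀ x : ℝ, IsPathConnected ({x} : Set ℝ) := isPathConnected_singleton
  have j₁ := joinedIn_genusTwoPoint ε hε h (θ' := θ) (φ' := Real.pi)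
    (by linarith [Real.cos_le_one θ, Real.cos_pi])
    ((hsingle θ).prod (hball Real.pi (φ - Real.pi))) ⟨rfl, by simp [Real.dist_eq]⟩
    ⟨rfl, Metric.mem_closedBall_self (abs_nonneg _)⟩ (by
      rintro ⟨x, y⟩ ⟨rfl, hy⟩
      rw [Metric.mem_closedBall, Real.dist_eq] at hy
      have := Real.cos_le_cos_of_nonneg_of_le_pi (abs_nonneg _) hφ hy
      rw [Real.cos_abs, Real.cos_abs, Real.cos_sub_pi, Real.cos_sub_pi] at this
      simp only
      linarith) (by
      rintro ⟨x, y⟩ ⟨rfl, -⟩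
      exact Circle.exp_ne_neg_one hθ)
  have j₂ := joinedIn_genusTwoPoint ε hε (θ := θ) (φ := Real.pi) (θ' := 0) (φ' := Real.pi)
    (by linarith [Real.cos_le_one θ, Real.cos_pi]) (by simp)
    ((hball 0 θ).prod (hsingle Real.pi)) ⟨by simp, rfl⟩
    ⟨Metric.mem_closedBall_self (abs_nonneg _), rfl⟩ (by
      rintro ⟨x, y⟩ ⟨-, rfl⟩
      linarith [Real.cos_le_one x, Real.cos_pi]) (by
      rintro ⟨x, y⟩ ⟨hx, rfl⟩
      rw [Metric.mem_closedBall, Real.dist_eq, sub_zero] at hx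
      exact Circle.exp_ne_neg_one (hx.trans_lt hθ))
  have hpi := Real.pi_pos
  have j₃ := joinedIn_genusTwoPoint ε hε (θ := 0) (φ := Real.pi) (θ' := 0) (φ' := Real.pi / 2)
    (by simp) (by simp)
    ((hsingle 0).prod ((convex_Icc (Real.pi / 2) Real.pi).isPathConnected
      ⟨Real.pi, by constructor <;> linarith⟩))
    ⟨rfl, by constructor <;> linarith⟩ ⟨rfl, by constructor <;> linarith⟩ (by
      rintro ⟨x, y⟩ ⟨rfl, hy⟩
      have := Real.cos_nonpos_of_pi_div_two_le_of_le hy.1 (by linarith [hy.2])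
      simp only [Real.cos_zero]
      linarith) (by
      rintro ⟨x, y⟩ ⟨rfl, -⟩
      exact Circle.exp_ne_neg_one (by simpa using hpi))
  exact (j₁.trans j₂).trans j₃

theorem isPathConnected_markedGenusTwo_offCurves :
    IsPathConnected {v : GenusTwo | v.1.1 ≠ -1} := by
  refine ⟨genusTwoPoint 1 (by norm_num) 0 (Real.pi / 2) (by simp), ?_, fun {v} hv => ?_⟩
  · change Circle.exp 0 ≠ -1
    exact Circle.exp_ne_neg_one (by simpa using Real.pi_pos)
  have hε : ∃ (ε : ℝ) (_ : ε ^ 2 = 1), 0 ≤ ε * v.1.2.2 := by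
    rcases le_total 0 v.1.2.2 with h | h
    · exact ⟨1, by norm_num, by linarith⟩
    · exact ⟨-1, by norm_num, by linarith⟩
  obtain ⟨ε, hε, hs⟩ := hε
  have hre : ∀ z : Circle, ∀ θ, Circle.exp θ = z → Real.cos θ = (z : ℂ).re := by
    rintro _ θ rfl
    simp
  have hz := Circle.exp_arg v.1.1
  -- Taking the argument of `-w` and adding `π` gives an angle of `w` within `π` of `π`.
  have hw : Circle.exp (Complex.arg (-v.1.2.1 : Circle) + Real.pi) = v.1.2.1 := by
    rw [Circle.exp_add, Circle.exp_arg, Circle.exp_pi]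
    simp
  have harg : |Complex.arg (v.1.1 : ℂ)| < Real.pi := by
    refine lt_of_le_of_ne (Complex.abs_arg_le_pi _) fun h => hv ?_
    rw [← hz]
    rcases eq_or_eq_neg_of_abs_eq h with h | h
    · rw [h, Circle.exp_pi]
    · rw [h, Circle.exp_neg, Circle.exp_pi, inv_neg, inv_one]
  have hsq := v.2
  have hle : Real.cos (Complex.arg (v.1.1 : ℂ)) +
      Real.cos (Complex.arg (-v.1.2.1 : Circle) + Real.pi) ≤ 1 := by
    rw [hre _ _ hz, hre _ _ hw]
    nlinarith [sq_nonneg v.1.2.2]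
  have hvp : genusTwoPoint ε hε _ _ hle = v := by
    refine Subtype.ext (Prod.ext hz (Prod.ext hw ?_))
    change ε * √(1 - Real.cos _ - Real.cos _) = v.1.2.2
    have h₁ : v.1.2.2 ^ 2 = (ε * v.1.2.2) ^ 2 := by rw [mul_pow, hε, one_mul]
    rw [hre _ _ hz, hre _ _ hw, ← hsq, h₁, Real.sqrt_sq hs, ← mul_assoc, ← sq, hε, one_mul]
  have j := joinedIn_genusTwoPoint_base ε hε harg (by
    rw [add_sub_cancel_right]
    exact Complex.abs_arg_le_pi _) hle
  have hbase : genusTwoPoint ε hε 0 (Real.pi / 2) (by simp) =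
      genusTwoPoint 1 (by norm_num) 0 (Real.pi / 2) (by simp) := by
    refine Subtype.ext (Prod.ext rfl (Prod.ext rfl ?_))
    simp [genusTwoPoint]
  rw [hvp, hbase] at j
  exact j.symm

theorem isRegular_markedGenusTwo : markedGenusTwo.IsRegular where
  embC := isOpenEmbedding_genusTwoCollar 1 (one_pow 2)
  embD := isOpenEmbedding_genusTwoCollar (-1) neg_one_sq
  disj q q' h := by
    have h₁ := genusTwoCollar_pos 1 (one_pow 2) q
    have h₂ := genusTwoCollar_pos (-1) neg_one_sq q'
    change genusTwoCollar 1 (one_pow 2) q = genusTwoCollar (-1) neg_one_sq q' at h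
    rw [h] at h₁
    linarith
  isOpen_offCurves := by
    rw [markedGenusTwo_offCurves]
    exact isOpen_ne_fun (continuous_fst.comp continuous_subtype_val) continuous_const
  isPathConnected_offCurves := by
    rw [markedGenusTwo_offCurves]
    exact isPathConnected_markedGenusTwo_offCurves

/-! ### Transport of transient loops to arbitrary base points. -/

namespace Tower

open unitInterval

variable {P : Tower}

/-- Conjugate `β` by a path `δ` to the base point. Closed lifts stay closed, and the ends of `ρ`
move along lifts of the image of `δ` reversed, which stay distinct by unique lifting. -/
theorem hasTransientLoops_of_exists (cov : ∀ n, IsCoveringMap (P.p n))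
    (conn : ∀ n, PathConnectedSpace (P.M n))
    (h : ∀ n, ∃ (b₀ : P.M (n + 1)) (β : Path b₀ b₀),
      (∀ Λ : C(I, P.Limit), (∀ t, (Λ t).1 (n + 1) = β t) → Λ 1 = Λ 0) ∧
      ∃ a b : P.M (n + 1), a ≠ b ∧ ∃ ρ : Path a b, ∀ t, P.p n (ρ t) = P.p n (β t)) :
    P.HasTransientLoops := by
  intro n x
  obtain ⟨b₀, β, hβ, a, b, hab, ρ, hρ⟩ := h n
  obtain ⟨δ⟩ := (conn (n + 1)).joined (x.1 (n + 1)) b₀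
  refine ⟨δ.trans (β.trans δ.symm), fun Λ hΛ => ?_, ?_⟩
  · obtain ⟨y, A, hA⟩ := exists_lift cov δ (Λ 0) (by simpa using hΛ 0)
    obtain ⟨z, B, hB⟩ := exists_lift cov β y (by simpa using hA 1)
    obtain rfl : z = y := by simpa using hβ B.toContinuousMap hB
    have hL := Path.forall_trans_eq (f := fun w : P.Limit => w.1 (n + 1)) (g := id) hA
      (Path.forall_trans_eq (f := fun w : P.Limit => w.1 (n + 1)) (g := id) hB
        (γ' := A.symm) (δ' := δ.symm) fun t => hA (σ t))
    refine Subtype.ext (funext fun k => ?_)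
    have := eval_eq_of_eval_zero_eq cov (k := k) Λ (A.trans (B.trans A.symm)).toContinuousMap
      (eval_eq_of_lift_eq fun t => (hΛ t).trans (hL t).symm) (s := 0) (by simp) 1
    simpa using this
  · have hlift : ∀ e : P.M (n + 1), P.p n e = P.p n b₀ →
        ∃ Γ : C(I, P.M (n + 1)), (∀ t, P.p n (Γ t) = P.p n (δ.symm t)) ∧ Γ 0 = e := by
      intro e he
      obtain ⟨Γ, hΓ, h0⟩ := (cov n).exists_path_lifts (δ.symm.map (P.cont n)).toContinuousMap e
        (by simpa using he.symm)
      exact ⟨Γ, congrFun hΓ, h0⟩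
    obtain ⟨Γa, hΓa, ha⟩ := hlift a (by simpa using hρ 0)
    obtain ⟨Γb, hΓb, hb⟩ := hlift b (by simpa using hρ 1)
    let Ea : Path a (Γa 1) := ⟨Γa, ha, rfl⟩
    let Eb : Path b (Γb 1) := ⟨Γb, hb, rfl⟩
    refine ⟨Γa 1, Γb 1, fun e => hab ?_, Ea.symm.trans (ρ.trans Eb),
      Path.forall_trans_eq (fun t => ?_) (Path.forall_trans_eq hρ hΓb)⟩
    · have := (cov n).eq_of_comp_eq Γa.continuous Γb.continuous
        (funext fun t => (hΓa t).trans (hΓb t).symm) 1 e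
      rw [← ha, ← hb]
      exact congrFun this 0
    · have := hΓa (σ t)
      rw [Path.symm_apply, Function.comp_apply, unitInterval.symm_symm] at this
      exact this

end Tower

/-! ### The Schori tower. -/

section Schori

open unitInterval

theorem isRegular_schoriSurface (c d : ℕ → Bool) : ∀ n, (schoriSurface c d n).IsRegular
  | 0 => isRegular_markedGenusTwo
  | n + 1 => (isRegular_schoriSurface c d n).triple (c n) (d n)

theorem isCoveringMap_schoriTower (c d : ℕ → Bool) (n : ℕ) :
    IsCoveringMap ((schoriTower c d).p n) :=
  MarkedSurface.isCoveringMap_proj (isRegular_schoriSurface c d n)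

theorem pathConnectedSpace_schoriTower (c d : ℕ → Bool) (n : ℕ) :
    PathConnectedSpace ((schoriTower c d).M n) :=
  (isRegular_schoriSurface c d n).pathConnectedSpace

/-- A path in the limit that avoids the marked curves at some level stays in one sheet at all
higher levels. -/
theorem schoriTower_eq_of_offCurves (c d : ℕ → Bool) {m : ℕ} (Λ : C(I, (schoriTower c d).Limit))
    (hoff : ∀ t, (Λ t).1 m ∈ (schoriSurface c d m).offCurves)
    (hm : (Λ 1).1 m = (Λ 0).1 m) : Λ 1 = Λ 0 := by
  -- The induction closes because the marked curves of a stage lie over those of the stage before: a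
  -- path off the curves stays in one sheet and is again off the curves.
  have key : ∀ ℓ, m ≤ ℓ → (∀ t, (Λ t).1 ℓ ∈ (schoriSurface c d ℓ).offCurves) ∧
      (Λ 1).1 ℓ = (Λ 0).1 ℓ := by
    intro ℓ hℓ
    induction ℓ, hℓ using Nat.le_induction with
    | base => exact ⟨hoff, hm⟩
    | succ ℓ _ ih =>
      have hp : ∀ t, (schoriSurface c d ℓ).proj ((Λ t).1 (ℓ + 1)) = (Λ t).1 ℓ :=
        fun t => (Λ t).2 ℓ
      have hoff' : ∀ t, (schoriSurface c d ℓ).proj ((Λ t).1 (ℓ + 1)) ∈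
          (schoriSurface c d ℓ).offCurves := fun t => by
        rw [hp]
        exact ih.1 t
      refine ⟨fun t => MarkedSurface.mem_offCurves_triple_of_proj (hoff' t), Prod.ext ?_ ?_⟩
      · exact (hp 1).trans (ih.2.trans (hp 0).symm)
      · exact (isRegular_schoriSurface c d ℓ).snd_lift_eq
          (Γ := ⟨fun t => (Λ t).1 (ℓ + 1), (Tower.continuous_eval (ℓ + 1)).comp Λ.continuous⟩)
          hoff' 1
  refine Subtype.ext (funext fun ℓ => ?_)
  rcases le_total m ℓ with h | h
  · exact (key ℓ h).2
  · exact Tower.eval_eq_of_le hm h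

theorem hasTransientLoops_schoriTower (c d : ℕ → Bool) :
    (schoriTower c d).HasTransientLoops := by
  refine Tower.hasTransientLoops_of_exists (isCoveringMap_schoriTower c d)
    (pathConnectedSpace_schoriTower c d) fun n => ?_
  obtain ⟨b, β, ρ, hβ, hρ⟩ := (isRegular_schoriSurface c d n).exists_crossing_loop (c n) (d n)
  refine ⟨(schoriSurface c d n).copy 2 b, β, fun Λ hΛ => ?_, (schoriSurface c d n).copy 0 b,
    (schoriSurface c d n).copy 1 b, fun h => ?_, ρ, hρ⟩
  · refine schoriTower_eq_of_offCurves c d (m := n + 1) Λ (fun t => ?_) ?_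
    · rw [hΛ]
      exact hβ t
    · rw [hΛ, hΛ]
      exact β.target.trans β.source.symm
  · have h01 : (0 : Fin 3) = 1 := congrArg Prod.snd h
    exact absurd h01 (by decide)

theorem card_preimage_schoriTower (c d : ℕ → Bool) (n : ℕ) (y : (schoriTower c d).M n) :
    Nat.card ((schoriTower c d).p n ⁻¹' {y}) = 3 := by
  let e : (schoriTower c d).p n ⁻¹' {y} ≃ Fin 3 :=
    { toFun := fun x => (show (schoriSurface c d n).Copies from x.1).2
      invFun := fun i => ⟨(schoriSurface c d n).copy i y, rfl⟩
      left_inv := fun x => Subtype.ext (Prod.ext (Eq.symm x.2) rfl)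
      right_inv := fun i => rfl }
  rw [Nat.card_congr e, Nat.card_fin]

end Schori

end

theorem corollary1p6 (c d : ℕ → Bool) :
    (∀ n : ℕ, ConnectedSpace ((schoriTower c d).M n) ∧
      IsCoveringMap ((schoriTower c d).p n) ∧
      ∀ y : (schoriTower c d).M n, Nat.card ((schoriTower c d).p n ⁻¹' {y}) = 3) ∧
    (∀ x : (schoriTower c d).Limit, ¬ ((schoriTower c d).groupChain x).IsStable) ∧
    (∀ x₀ : (schoriTower c d).M 0, IsWildAction ((schoriTower c d).monodromyGroup x₀)) := by
  have cov := isCoveringMap_schoriTower c d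
  have conn := pathConnectedSpace_schoriTower c d
  have loops := hasTransientLoops_schoriTower c d
  refine ⟨fun n => ⟨?_, cov n, card_preimage_schoriTower c d n⟩,
    Tower.not_isStable_groupChain cov conn loops,
    Tower.isWildAction_monodromyGroup cov conn (coord := fun n => Equiv.refl _)
      (fun n x => rfl) loops⟩
  have := conn n
  infer_instance
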